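/- \textbf{Setting.} Let $\{Y_i\}_{i\in\mathbb Z}$ and, for every $m\in\mathbb N$, $\{Z_{i,m}\}_{i\in\mathbb Z}$ be strictly stationary real time series on one probability space, let $\lambda>0$, $\beta\ge 0$, $k^*=\lfloor\lambda m^\beta\rfloor$, and observe $$X_{i,m}=Y_i\ \ (1\le i\le m+k^*),\qquad X_{i,m}=Z_{i,m}\ \ (i>m+k^*).$$ Let $h:\mathbb R^2\to\mathbb R$ be measurable, and let $Y$ be a copy of $Y_1$ that is independent of $Y_1$ and of $Z_{1,m}$. Put $\theta=E\,h(Y,Y_1)$, $\theta_m^*=E\,h(Y,Z_{1,m})$ (both assumed to exist), $\Delta_m=\theta_m^*-\theta$, and $$h_1(s)=E\,h(s,Y_1)-\theta,\quad h_2(t)=E\,h(Y_1,t)-\theta,\quad h^*_{1,m}(s)=E\,h(s,Z_{1,m})-\theta^*_m,\quad h^*_{2,m}(t)=E\,h(Y_1,t)-\theta_m^*,$$ $$r(s,t)=h(s,t)-h_1(s)-h_2(t)-\theta,\qquad r^*_m(s,t)=h(s,t)-h^*_{1,m}(s)-h^*_{2,m}(t)-\theta^*_m,$$ $$S_{1,m}=\frac1{\sqrt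 m}\sum_{i=1}^m h_1(Y_i),\qquad S^*_{1,m}=\frac1{\sqrt m}\sum_{i=1}^m h^*_{1,m}(Y_i),$$ $$\Gamma(m,k)=\frac1m\sum_{i=1}^m\sum_{j=m+1}^{m+k}\bigl(h(X_{i,m},X_{j,m})-\theta\bigr),\qquad w(m,k)=\frac{1}{\sqrt m\,(1+k/m)}.$$ For thresholds $c_m\in\mathbb R$ the delay time is $\kappa_m=\inf\{k>k^*:\ w(m,k)|\Gamma(m,k)|>c_m\}$ (with $\inf\emptyset=\infty$). \textbf{Assumptions.} All limits are for $m\to\infty$. \begin{enumerate} \item (Size of the change) $\Delta_m=O(1)$ and $\sqrt m|\Delta_m|/c_m\to\infty$. \item (Regularity before the change) There are $u(m)$ with $\frac{u(m)}{m^2}(\log m)^2\to0$ and $E\bigl|\sum_{i=1}^m\sum_{j=k_1}^{k_2}r(Y_i,Y_j)\bigr|^2\le u(m)(k_2-k_1+1)$ for all $m+1\le k_1\le k_2$. For all sequences $k_m\to\infty$ of natural numbers, $\sup_{1\le k\le k_m}\frac1{\sqrt{k_m}}\bigl|\sum_{j=m+1}^{m+k}h_2(Y_j)\bigr|=O_P(1)$.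 \item (Threshold) $S_{1,m}=O_P(1)$, $S^*_{1,m}=O_P(1)$, $\liminf_m c_m>0$ and $c_m\max(1,m^{1-\beta})\to\infty$. \item (Independence) For every $m$, the monitoring data $\{X_{m+j,m}:j\ge1\}$ are independent of $(S_{1,m},S^*_{1,m})$. \item (Regularity after the change) There are $u(m)$ with $\frac{u(m)}{m^2}(\log m)^2\to0$ and $E\bigl|\sum_{i=1}^m\sum_{j=k_1}^{k_2}r^*_m(Y_i,Z_{j,m})\bigr|^2\le u(m)(k_2-k_1+1)$ for all $m+1\le k_1\le k_2$. For all $0\le\alpha<\frac12$ and all sequences $l_m\to\infty$, $\sup_{1\le l\le l_m}\frac{1}{l_m^{1/2-\alpha}\,l^{\alpha}}\bigl|\sum_{j=m+k^*+1}^{m+k^*+l}h^*_{2,m}(Z_{j,m})\bigr|=O_P(1)$. \item The limit $D=\lim_{m\to\infty} m^{\beta-1}\frac{\sqrt m|\Delta_m|}{c_m}\in[0,\infty]$ exists. \begin{itemize} \item If $D<\infty$: for every $m$ the series $\{(Y_i,Z_{i,m})\}_{i\in\mathbb Z}$ is jointly strictly stationary, and for all $k_m\to\infty$ $$\Bigl\{\tfrac{1}{\sqrt{k_m}}\sum_{j=1}^{\lfloor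 k_mt\rfloor}\bigl(h_2(Y_j),h^*_{2,m}(Z_{j,m})\bigr):0\le t\le1\Bigr\}\ \xrightarrow{\ \mathcal D\ }\ \{(W(t),W^*(t)):0\le t\le1\},$$ where $(W,W^*)$ is a centered bivariate Wiener process with $\sigma^2=\operatorname{Var}W(1)>0$ and $\sigma^{*2}=\operatorname{Var}W^*(1)>0$ (arbitrary correlation). \item If $D=\infty$: for all $k_m\to\infty$, $\frac1{\sqrt{k_m}}\sum_{j=1}^{k_m}h_2(Y_j)\xrightarrow{\mathcal D}N(0,\sigma^2)$ with $\sigma^2>0$, and $\sup_{1\le l\le k_m}\frac{1}{\sqrt{k_m}}\bigl|\sum_{j=m+k^*+1}^{m+k^*+l}h^*_{2,m}(Z_{j,m})\bigr|=O_P(1)$. \end{itemize} \end{enumerate} \textbf{Theorem.} Let $$a_m=a_m(S_{1,m},S^*_{1,m})=\Bigl(1-\frac{c_m}{\sqrt m|\Delta_m|}+\frac{S^*_{1,m}\operatorname{sign}(\Delta_m)}{\sqrt m|\Delta_m|}\Bigr)^{-1}\Bigl(k^*+k^*\frac{(S^*_{1,m}-S_{1,m})\operatorname{sign}(\Delta_m)}{\sqrt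 m|\Delta_m|}+\frac{c_m\sqrt m}{|\Delta_m|}\Bigr),$$ $b_m=b_m(S_{1,m},S^*_{1,m})=\sqrt{a_m}/|\Delta_m|$, and $$\sigma_\infty^2=\begin{cases}\sigma^{*2}, & D=0,\\[2pt] \frac{\lambda D}{1+\lambda D}\,\sigma^2+\frac1{1+\lambda D}\,\sigma^{*2}, & 0<D<\infty,\\[2pt] \sigma^2, & D=\infty.\end{cases}$$ Then, for every $x\in\mathbb R$, as $m\to\infty$, $$P\Bigl(\frac{\kappa_m-a_m(S_{1,m},S^*_{1,m})}{b_m(S_{1,m},S^*_{1,m})}\le x\ \Big|\ S_{1,m},S^*_{1,m}\Bigr)\ \xrightarrow{\ P\ }\ \Phi\Bigl(\frac{x}{\sigma_\infty}\Bigr),$$ where $\Phi$ is the standard normal distribution function. -/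

import Mathlib

open MeasureTheory ProbabilityTheory Filter Topology
open scoped ENNReal NNReal UniformConvergence

noncomputable section

namespace UStatMonitoring

/-! ### General probabilistic notions -/

/-- Strict stationarity of a two-sided sequence: all shifts have the same law on path space. -/
def IsStrictlyStationary {Ω E : Type*} [MeasurableSpace Ω] [MeasurableSpace E]
    (P : Measure Ω) (V : ℤ → Ω → E) : Prop :=
  ∀ n : ℤ, P.map (fun ω (i : ℤ) => V (i + n) ω) = P.map (fun ω (i : ℤ) => V i ω)

/-- `ξ m = O_P(1)` as `m → ∞`. -/
def IsBoundedInProb {Ω : Type*} [MeasurableSpace Ω] (P : Measure Ω) (ξ : ℕ → Ω → ℝ) : Prop :=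
  ∀ ε : ℝ, 0 < ε → ∃ K : ℝ, ∀ᶠ m in atTop, P {ω | K < |ξ m ω|} ≤ ENNReal.ofReal ε

/-- `max_{1 ≤ l ≤ n} |f l|` (and `0` for `n = 0`). -/
def maxAbs (n : ℕ) (f : ℕ → ℝ) : ℝ :=
  (((Finset.Icc 1 n).sup fun l => ‖f l‖₊ : ℝ≥0) : ℝ)

/-- A centered bivariate Wiener process `(W, W*)` on `[0,1]` with `Var W(1) = σ²`,
`Var W*(1) = σs²` and `Cov (W(1), W*(1)) = γ`. That the increments are centered Gaussian vectors
is expressed through all their linear combinations. -/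
structure IsBivariateWiener {Ω' : Type*} [MeasurableSpace Ω'] (Q : Measure Ω')
    (B : unitInterval → Ω' → ℝ × ℝ) (σ σs γ : ℝ) : Prop where
  measurable : ∀ t, Measurable (B t)
  zero : ∀ ω, B 0 ω = 0
  continuous_paths : ∀ ω, Continuous fun t => B t ω
  indep_increments : HasIndepIncrements B Q
  gaussian_increments : ∀ s t : unitInterval, s ≤ t → ∀ u v : ℝ,
    Q.map (fun ω => u * ((B t ω).1 - (B s ω).1) + v * ((B t ω).2 - (B s ω).2)) =
      gaussianReal 0
        (Real.toNNReal (((t : ℝ) - s) * (u ^ 2 * σ ^ 2 + 2 * (u * v * γ) + v ^ 2 * σs ^ 2)))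

/-- Convergence in distribution of processes with paths `[0,1] → ℝ²`: convergence of the
expectations of all bounded functionals that are continuous for the uniform distance and
measurable for the σ-algebra generated by the coordinates. For càdlàg processes and a limit with
continuous paths this is equivalent to weak convergence in the Skorokhod space. -/
def PathsTendstoInDistribution {Ω Ω' : Type*} [MeasurableSpace Ω] [MeasurableSpace Ω']
    (P : Measure Ω) (ξ : ℕ → unitInterval → Ω → ℝ × ℝ)
    (Q : Measure Ω') (B : unitInterval → Ω' → ℝ × ℝ) : Prop :=
  ∀ f : (unitInterval → ℝ × ℝ) → ℝ,
    Measurable f → (∃ C : ℝ, ∀ p, |f p| ≤ C) →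
    Continuous (fun p : unitInterval →ᵤ (ℝ × ℝ) => f (UniformFun.toFun p)) →
    Tendsto (fun m => ∫ ω, f (fun t => ξ m t ω) ∂P) atTop (𝓝 (∫ ω, f (fun t => B t ω) ∂Q))

/-! ### The monitoring model -/

/-- The data of the change point model: the kernel `h`, the time series `Y` before the change, the
time series `Z m` after the change (for historic sample size `m`), the constants `lam`, `beta`
that determine the time of change, and the thresholds `c m`. -/
structure Model (Ω : Type*) where
  h : ℝ → ℝ → ℝ
  Y : ℤ → Ω → ℝ
  Z : ℕ → ℤ → Ω → ℝ
  lam : ℝ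
  beta : ℝ
  c : ℕ → ℝ

namespace Model

variable {Ω : Type*} [MeasurableSpace Ω] (M : Model Ω) (P : Measure Ω)

/-- `k* = ⌊λ m^β⌋`. -/
def kstar (m : ℕ) : ℕ := ⌊M.lam * (m : ℝ) ^ M.beta⌋₊

/-- The observations `X_{i,m}`, `i ≥ 1`. -/
def X (m i : ℕ) (ω : Ω) : ℝ := if i ≤ M.kstar m + m then M.Y i ω else M.Z m i ω

/-- `θ = E h(Y, Y₁)`, where `Y` is an independent copy of `Y₁`. -/
def theta : ℝ := ∫ p, M.h p.1 p.2 ∂((P.map (M.Y 1)).prod (P.map (M.Y 1)))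

/-- `θ*_m = E h(Y, Z_{1,m})`, where `Y` is a copy of `Y₁` that is independent of `Z_{1,m}`. -/
def thetaStar (m : ℕ) : ℝ := ∫ p, M.h p.1 p.2 ∂((P.map (M.Y 1)).prod (P.map (M.Z m 1)))

/-- The size of the change, `Δ_m = θ*_m - θ`. -/
def Delta (m : ℕ) : ℝ := M.thetaStar P m - M.theta P

def h1 (s : ℝ) : ℝ := ∫ ω, (M.h s (M.Y 1 ω) - M.theta P) ∂P

def h1Star (m : ℕ) (s : ℝ) : ℝ := ∫ ω, (M.h s (M.Z m 1 ω) - M.thetaStar P m) ∂P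

def h2 (t : ℝ) : ℝ := ∫ ω, (M.h (M.Y 1 ω) t - M.theta P) ∂P

def h2Star (m : ℕ) (t : ℝ) : ℝ := ∫ ω, (M.h (M.Y 1 ω) t - M.thetaStar P m) ∂P

def r (s t : ℝ) : ℝ := M.h s t - M.h1 P s - M.h2 P t - M.theta P

def rStar (m : ℕ) (s t : ℝ) : ℝ :=
  M.h s t - M.h1Star P m s - M.h2Star P m t - M.thetaStar P m

/-- The historic statistic `S_{1,m}`. -/
def S1 (m : ℕ) (ω : Ω) : ℝ := (1 / √(m : ℝ)) * ∑ i ∈ Finset.Icc 1 m, M.h1 P (M.Y (i : ℤ) ω)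

/-- The historic statistic `S*_{1,m}`. -/
def S1Star (m : ℕ) (ω : Ω) : ℝ :=
  (1 / √(m : ℝ)) * ∑ i ∈ Finset.Icc 1 m, M.h1Star P m (M.Y (i : ℤ) ω)

/-- The monitoring statistic `Γ(m,k)`. -/
def Gam (m k : ℕ) (ω : Ω) : ℝ :=
  (1 / (m : ℝ)) * ∑ i ∈ Finset.Icc 1 m, ∑ j ∈ Finset.Icc (m + 1) (m + k),
    (M.h (M.X m i ω) (M.X m j ω) - M.theta P)

/-- The weight function `w(m,k) = (m^{1/2} (1 + k/m))⁻¹`. -/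
def w (m k : ℕ) : ℝ := (√(m : ℝ) * (1 + (k : ℝ) / m))⁻¹

/-- The delay time `κ_m = inf {k > k* : w(m,k) |Γ(m,k)| > c_m}`, with `inf ∅ = ∞`. -/
def kappa (m : ℕ) (ω : Ω) : ℕ∞ :=
  sInf {n : ℕ∞ | ∃ k : ℕ, n = k ∧ M.kstar m < k ∧ M.c m < w m k * |M.Gam P m k ω|}

/-- The standardizing sequence `a_m(s, s*)`. -/
def a (m : ℕ) (s sStar : ℝ) : ℝ :=
  (1 - M.c m / (√(m : ℝ) * |M.Delta P m|)
      + sStar * Real.sign (M.Delta P m) / (√(m : ℝ) * |M.Delta P m|))⁻¹ *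
    (M.kstar m
      + M.kstar m * ((sStar - s) * Real.sign (M.Delta P m) / (√(m : ℝ) * |M.Delta P m|))
      + M.c m * √(m : ℝ) / |M.Delta P m|)

/-- The standardizing sequence `b_m(s, s*)`. -/
def b (m : ℕ) (s sStar : ℝ) : ℝ := √(M.a P m s sStar) / |M.Delta P m|

/-- `(κ_m - a_m(S_{1,m}, S*_{1,m})) / b_m(S_{1,m}, S*_{1,m})`, which is `∞` where `κ_m = ∞`. -/
def standardizedDelay (m : ℕ) (ω : Ω) : EReal :=
  (((M.kappa P m ω : ℝ≥0∞) : EReal) - (M.a P m (M.S1 P m ω) (M.S1Star P m ω) : ℝ)) /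
    (M.b P m (M.S1 P m ω) (M.S1Star P m ω) : ℝ)

/-- The σ-algebra generated by `(S_{1,m}, S*_{1,m})`. -/
@[reducible] def historicSigma (m : ℕ) : MeasurableSpace Ω :=
  MeasurableSpace.comap (fun ω => (M.S1 P m ω, M.S1Star P m ω)) inferInstance

/-- The sequence `m^{β-1} √m |Δ_m| / c_m`, whose limit in `[0,∞]` determines the limit variance. -/
def rate (m : ℕ) : ℝ≥0∞ :=
  ENNReal.ofReal ((m : ℝ) ^ (M.beta - 1) * (√(m : ℝ) * |M.Delta P m| / M.c m))

/-! ### The assumptions -/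

/-- The setting: `Y` and `Z m` are stationary time series, the kernel is measurable, the
expectations that define `θ` and `θ*_m` exist, `λ > 0` and `β ≥ 0`. -/
structure Setting : Prop where
  lam_pos : 0 < M.lam
  beta_nonneg : 0 ≤ M.beta
  measurable_h : Measurable (Function.uncurry M.h)
  measurable_Y : ∀ i, Measurable (M.Y i)
  measurable_Z : ∀ m i, Measurable (M.Z m i)
  stationary_Y : IsStrictlyStationary P M.Y
  stationary_Z : ∀ m, IsStrictlyStationary P (M.Z m)
  integrable_theta :
    Integrable (fun p : ℝ × ℝ => M.h p.1 p.2) ((P.map (M.Y 1)).prod (P.map (M.Y 1)))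
  integrable_thetaStar : ∀ m,
    Integrable (fun p : ℝ × ℝ => M.h p.1 p.2) ((P.map (M.Y 1)).prod (P.map (M.Z m 1)))

/-- The change is bounded and asymptotically detectable. -/
structure ChangeSize : Prop where
  bounded : ∃ C : ℝ, ∀ᶠ m in atTop, |M.Delta P m| ≤ C
  detectable : Tendsto (fun m : ℕ => √(m : ℝ) * |M.Delta P m| / M.c m) atTop atTop

/-- Regularity of the time series before the change. -/
structure RegularBefore : Prop where
  remainder : ∃ u : ℕ → ℝ,
    (∀ m k₁ k₂ : ℕ, m + 1 ≤ k₁ → k₁ ≤ k₂ →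
      ∫⁻ ω, ENNReal.ofReal
          (|∑ i ∈ Finset.Icc 1 m, ∑ j ∈ Finset.Icc k₁ k₂,
              M.r P (M.Y (i : ℤ) ω) (M.Y (j : ℤ) ω)| ^ 2) ∂P
        ≤ ENNReal.ofReal (u m * ((k₂ : ℝ) - k₁ + 1))) ∧
    Tendsto (fun m : ℕ => u m / (m : ℝ) ^ 2 * Real.log m ^ 2) atTop (𝓝 0)
  partial_sums : ∀ k : ℕ → ℕ, Tendsto k atTop atTop →
    IsBoundedInProb P fun m ω =>
      maxAbs (k m) fun l =>
        (1 / √(k m : ℝ)) * ∑ j ∈ Finset.Icc (m + 1) (m + l), M.h2 P (M.Y (j : ℤ) ω)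

/-- The assumptions on the threshold and the historic statistics. `liminf c_m > 0` is expressed
by an eventual positive lower bound. -/
structure Threshold : Prop where
  S1_bounded : IsBoundedInProb P (M.S1 P)
  S1Star_bounded : IsBoundedInProb P (M.S1Star P)
  liminf_pos : ∃ ε : ℝ, 0 < ε ∧ ∀ᶠ m in atTop, ε ≤ M.c m
  growth : Tendsto (fun m : ℕ => M.c m * max 1 ((m : ℝ) ^ (1 - M.beta))) atTop atTop

/-- The monitoring data `{X_{m+j} : j ≥ 1}` are independent of `(S_{1,m}, S*_{1,m})`. -/
def HistoricIndep : Prop :=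
  ∀ m : ℕ, IndepFun (fun ω => (M.S1 P m ω, M.S1Star P m ω))
    (fun ω (j : ℕ) => M.X m (m + (j + 1)) ω) P

/-- Regularity of the time series after the change. -/
structure RegularAfter : Prop where
  remainder : ∃ u : ℕ → ℝ,
    (∀ m k₁ k₂ : ℕ, m + 1 ≤ k₁ → k₁ ≤ k₂ →
      ∫⁻ ω, ENNReal.ofReal
          (|∑ i ∈ Finset.Icc 1 m, ∑ j ∈ Finset.Icc k₁ k₂,
              M.rStar P m (M.Y (i : ℤ) ω) (M.Z m (j : ℤ) ω)| ^ 2) ∂P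
        ≤ ENNReal.ofReal (u m * ((k₂ : ℝ) - k₁ + 1))) ∧
    Tendsto (fun m : ℕ => u m / (m : ℝ) ^ 2 * Real.log m ^ 2) atTop (𝓝 0)
  hajek_renyi : ∀ α : ℝ, 0 ≤ α → α < 1 / 2 → ∀ n : ℕ → ℕ, Tendsto n atTop atTop →
    IsBoundedInProb P fun m ω =>
      maxAbs (n m) fun l =>
        (1 / ((n m : ℝ) ^ (1 / 2 - α) * (l : ℝ) ^ α)) *
          ∑ j ∈ Finset.Icc (m + M.kstar m + 1) (m + M.kstar m + l),
            M.h2Star P m (M.Z m (j : ℤ) ω)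

/-- The partial sum process
`t ↦ k_m^{-1/2} ∑_{j ≤ k_m t} (h₂(Y_j), h*_{2,m}(Z_{j,m}))`, `0 ≤ t ≤ 1`. -/
def partialSumPath (k : ℕ → ℕ) (m : ℕ) (t : unitInterval) (ω : Ω) : ℝ × ℝ :=
  ((1 / √(k m : ℝ)) * ∑ j ∈ Finset.Icc 1 ⌊(k m : ℝ) * (t : ℝ)⌋₊, M.h2 P (M.Y (j : ℤ) ω),
   (1 / √(k m : ℝ)) * ∑ j ∈ Finset.Icc 1 ⌊(k m : ℝ) * (t : ℝ)⌋₊, M.h2Star P m (M.Z m (j : ℤ) ω))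

/-- The joint functional central limit theorem for the series before and after the change, which
are jointly stationary here, with a bivariate Wiener limit (the same for all `k_m → ∞`) both
components of which are non-degenerate, with variances `σ²` and `σs²`. -/
structure JointFCLT (σ σs : ℝ) : Prop where
  stationary : ∀ m, IsStrictlyStationary P fun i ω => (M.Y i ω, M.Z m i ω)
  sigma_pos : 0 < σ
  sigmaStar_pos : 0 < σs
  fclt : ∃ (Ω' : Type) (_ : MeasurableSpace Ω') (Q : Measure Ω') (B : unitInterval → Ω' → ℝ × ℝ)
    (γ : ℝ), IsProbabilityMeasure Q ∧ IsBivariateWiener Q B σ σs γ ∧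
      ∀ k : ℕ → ℕ, Tendsto k atTop atTop →
        PathsTendstoInDistribution P (M.partialSumPath P k) Q B

/-- The conditions for later changes: a central limit theorem with limit `N(0, σ²)`, `σ > 0`, before
the change, and bounded maximal partial sums after the change. -/
structure LaterCLT [IsProbabilityMeasure P] (σ : ℝ) : Prop where
  sigma_pos : 0 < σ
  clt : ∀ k : ℕ → ℕ, Tendsto k atTop atTop →
    TendstoInDistribution
      (fun m ω => (1 / √(k m : ℝ)) * ∑ j ∈ Finset.Icc 1 (k m), M.h2 P (M.Y (j : ℤ) ω))
      atTop (id : ℝ → ℝ) (fun _ => P) (gaussianReal 0 (Real.toNNReal (σ ^ 2)))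
  partial_sums : ∀ k : ℕ → ℕ, Tendsto k atTop atTop →
    IsBoundedInProb P fun m ω =>
      maxAbs (k m) fun l =>
        (1 / √(k m : ℝ)) * ∑ j ∈ Finset.Icc (m + M.kstar m + 1) (m + M.kstar m + l),
          M.h2Star P m (M.Z m (j : ℤ) ω)

open Classical in
/-- The limit variance `σ_∞²`, for the limit `D ∈ [0,∞]` of `rate`. -/
def limitVariance (D : ℝ≥0∞) (σ σs : ℝ) : ℝ :=
  if D = 0 then σs ^ 2
  else if D = ⊤ then σ ^ 2
  else M.lam * D.toReal / (1 + M.lam * D.toReal) * σ ^ 2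
    + 1 / (1 + M.lam * D.toReal) * σs ^ 2

end Model

end UStatMonitoring

end

/-!
The Hoeffding decompositions of the kernel with respect to
the laws before and after the change split the detector, at time `k* + l`, into a drift that is
linear in `l`, with coefficients that depend on the historic statistics `S₁` and `S₁*` only, and into
noise from the monitoring period (`Gam_eq`). The threshold for the detector is linear in `l` as well,
and `a_m` is exactly the time at which the drift meets the threshold. So, after multiplication by the
sign of `Δ_m`, the detector crosses the threshold at time `k` iff
`|Δ_m| (1 + o(1)) (k - a_m) + noise > 0`. To first order, `a_m` is the deterministic time
`a₀ = k* + c_m √m / |Δ_m|`, and the noise is of the order `√a₀`, so that deviations from `a_m` are of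
the order `√a₀ / |Δ_m|`, that is, of the order of `b_m`.

The noise has a linear part, from `h₂` and `h₂*`, and a degenerate part. The degenerate part is
negligible: before the change by Chebyshev's inequality, after the change uniformly in time by a
maximal inequality of Rademacher–Menshov type (`measure_exists_lt_abs_sum_range_le`), which is where
`(log m)²` comes from. Stationarity lets the bounds for the maximal partial sums start at any time
(`blockMaximaBounded_of_isBoundedInProb`). Hence the linear part is `O_P(√a₀)` up to twice the
approximate detection time, and it varies only by `o_P(√a₀)` close to that time, where it can be
replaced by its value at a deterministic time, the `standardizedNoise`.

A deterministic argument for single paths (`exists_crossing_sandwich`) now shows: outside of events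
of vanishing probability, a crossing not later than `a_m + x b_m` implies `T ≤ x + δ` and follows
from `T ≤ x - δ`, where `T` is the standardized noise times the negative sign of `Δ_m`
(`exists_bad_event`). As `T` is a function of the monitoring data, it is independent of the historic
statistics, and the conditional probabilities converge to the limit of `P (T ≤ x)`
(`tendstoInMeasure_condExp_of_sandwich`).

It remains to find the limit law of `T`. If `D = ∞` then `k* / a₀ → 1`, and the central limit theorem
for the series before the change applies. If `D < ∞` then `k* / a₀ → ρ = λ D / (1 + λ D)`; joint
stationarity moves the monitoring period to the beginning of the series, and the limit is
`W(ρ) + W*(1) - W*(ρ)`. Its two parts are independent whatever the correlation of `W` and `W*`, since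
they are increments over disjoint intervals (`IsBivariateWiener.map_eq`).
-/

namespace UStatMonitoring

/-! ### Stochastic boundedness and block sums -/

section BlockSum

variable {Ω E : Type*}

/-- `∑_{j = p + 1}^{p + l} g(V_j)`. -/
def blockSum (g : E → ℝ) (V : ℤ → Ω → E) (p l : ℕ) (ω : Ω) : ℝ :=
  ∑ j ∈ Finset.Icc (p + 1) (p + l), g (V (j : ℤ) ω)

@[simp] lemma blockSum_zero (g : E → ℝ) (V : ℤ → Ω → E) (p : ℕ) (ω : Ω) :
    blockSum g V p 0 ω = 0 := by
  simp [blockSum]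

lemma blockSum_eq_sum_shift (g : E → ℝ) (V : ℤ → Ω → E) (p l : ℕ) (ω : Ω) :
    blockSum g V p l ω = ∑ j ∈ Finset.Icc 1 l, g (V ((j : ℤ) + (p : ℤ)) ω) := by
  rw [blockSum, add_comm p 1, add_comm p l, ← Finset.map_add_right_Icc, Finset.sum_map]
  simp

lemma blockSum_add (g : E → ℝ) (V : ℤ → Ω → E) (p l l' : ℕ) (ω : Ω) :
    blockSum g V p (l + l') ω = blockSum g V p l ω + blockSum g V (p + l) l' ω := by
  simp only [blockSum, ← Finset.Ico_succ_right_eq_Icc, Order.succ_eq_add_one]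
  rw [← Finset.sum_Ico_consecutive _ (show p + 1 ≤ p + l + 1 by omega)
    (show p + l + 1 ≤ p + (l + l') + 1 by omega)]
  simp [add_assoc]

end BlockSum

section General

variable {Ω E : Type*} [MeasurableSpace Ω] [MeasurableSpace E] {P : Measure Ω}

lemma lt_maxAbs_iff {n : ℕ} {f : ℕ → ℝ} {K : ℝ} (hK : 0 ≤ K) :
    K < maxAbs n f ↔ ∃ l ∈ Finset.Icc 1 n, K < |f l| := by
  lift K to ℝ≥0 using hK
  rw [maxAbs, NNReal.coe_lt_coe, Finset.lt_sup_iff]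
  simp [← NNReal.coe_lt_coe]

lemma IsBoundedInProb.tendsto_measure_lt {ξ : ℕ → Ω → ℝ} (h : IsBoundedInProb P ξ) {τ : ℕ → ℝ}
    (hτ : Tendsto τ atTop atTop) : Tendsto (fun m => P {ω | τ m < |ξ m ω|}) atTop (𝓝 0) := by
  rw [ENNReal.tendsto_nhds_zero]
  intro ε hε
  obtain ⟨r, hr, hrε⟩ := ENNReal.lt_iff_exists_nnreal_btwn.1 hε
  obtain ⟨K, hK⟩ := h r (by exact_mod_cast hr)
  filter_upwards [hK, hτ.eventually_ge_atTop K] with m hm hτm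
  refine (measure_mono fun ω (hω : τ m < _) => ?_).trans (hm.trans ?_)
  · exact hτm.trans_lt hω
  · simpa using hrε.le

lemma tendsto_measure_zero_mono {A B : ℕ → Set Ω} (hB : Tendsto (fun m => P (B m)) atTop (𝓝 0))
    (h : ∀ᶠ m in atTop, A m ⊆ B m) : Tendsto (fun m => P (A m)) atTop (𝓝 0) :=
  tendsto_of_tendsto_of_tendsto_of_le_of_le' tendsto_const_nhds hB (by simp)
    (h.mono fun _ hm => measure_mono hm)

lemma tendsto_measure_zero_union {A B : ℕ → Set Ω} (hA : Tendsto (fun m => P (A m)) atTop (𝓝 0))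
    (hB : Tendsto (fun m => P (B m)) atTop (𝓝 0)) :
    Tendsto (fun m => P (A m ∪ B m)) atTop (𝓝 0) :=
  tendsto_of_tendsto_of_tendsto_of_le_of_le tendsto_const_nhds (by simpa using hA.add hB)
    (fun _ => by simp) fun _ => measure_union_le _ _

/-! ### Sums over blocks of a stationary series -/

lemma IsStrictlyStationary.map_comp_shift {β : Type*} [MeasurableSpace β] {V : ℤ → Ω → E}
    (h : IsStrictlyStationary P V) (hV : ∀ i, Measurable (V i)) {F : (ℤ → E) → β}
    (hF : Measurable F) (n : ℤ) :
    P.map (fun ω => F fun i => V (i + n) ω) = P.map (fun ω => F fun i => V i ω) := by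
  have h1 : Measurable fun ω (i : ℤ) => V (i + n) ω := measurable_pi_lambda _ fun i => hV _
  have h2 : Measurable fun ω (i : ℤ) => V i ω := measurable_pi_lambda _ fun i => hV _
  have := congrArg (Measure.map F) (h n)
  rwa [Measure.map_map hF h1, Measure.map_map hF h2] at this

lemma measurable_blockSum {g : E → ℝ} (hg : Measurable g) {V : ℤ → Ω → E}
    (hV : ∀ i, Measurable (V i)) (p l : ℕ) : Measurable (blockSum g V p l) :=
  Finset.measurable_sum _ fun j _ => hg.comp (hV j)

/-- The maxima of the sums over blocks of length `n` with arbitrary starting points are of the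
order `√n` in probability, if `n → ∞`. -/
def BlockMaximaBounded (P : Measure Ω) (g : ℕ → E → ℝ) (V : ℕ → ℤ → Ω → E) : Prop :=
  ∀ n p : ℕ → ℕ, Tendsto n atTop atTop → ∀ τ : ℕ → ℝ,
    Tendsto (fun m => τ m / √(n m : ℝ)) atTop atTop →
    Tendsto (fun m => P {ω | ∃ l ≤ n m, τ m < |blockSum (g m) (V m) (p m) l ω|}) atTop (𝓝 0)

/-- By stationarity it is enough to control the maxima over blocks with one given starting point. -/
lemma blockMaximaBounded_of_isBoundedInProb {g : ℕ → E → ℝ} {V : ℕ → ℤ → Ω → E}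
    (hg : ∀ m, Measurable (g m)) (hV : ∀ m i, Measurable (V m i))
    (hstat : ∀ m, IsStrictlyStationary P (V m)) (q : ℕ → ℕ)
    (h : ∀ n : ℕ → ℕ, Tendsto n atTop atTop → IsBoundedInProb P fun m ω =>
      maxAbs (n m) fun l => (1 / √(n m : ℝ)) * blockSum (g m) (V m) (q m) l ω) :
    BlockMaximaBounded P g V := by
  intro n p hn τ hτ
  -- the event is defined by finitely many coordinates of the shifted path
  have key : ∀ m, P {ω | ∃ l ≤ n m, τ m < |blockSum (g m) (V m) (p m) l ω|} =
      P {ω | ∃ l ≤ n m, τ m < |blockSum (g m) (V m) (q m) l ω|} := by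
    intro m
    set A : Set (ℤ → E) := {z | ∃ l ≤ n m, τ m < |∑ j ∈ Finset.Icc 1 l, g m (z j)|} with hA
    have hAm : MeasurableSet A := by
      have : A = ⋃ l ∈ Finset.range (n m + 1),
          {z : ℤ → E | τ m < |∑ j ∈ Finset.Icc 1 l, g m (z j)|} := by
        ext z; simp [hA]
      rw [this]
      refine Finset.measurableSet_biUnion _ fun l _ => measurableSet_lt measurable_const ?_
      exact (Finset.measurable_sum _ fun j _ => (hg m).comp (measurable_pi_apply _)).abs
    have hs : ∀ p : ℕ, P {ω | ∃ l ≤ n m, τ m < |blockSum (g m) (V m) p l ω|} =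
        P {ω | (fun i => V m i ω) ∈ A} := by
      intro p
      have h1 : Measurable fun ω (i : ℤ) => V m (i + p) ω := measurable_pi_lambda _ fun i => hV m _
      have h2 : Measurable fun ω (i : ℤ) => V m i ω := measurable_pi_lambda _ fun i => hV m _
      have := congrArg (fun μ => μ A) (hstat m p)
      simp only [Measure.map_apply h1 hAm, Measure.map_apply h2 hAm] at this
      refine Eq.trans ?_ this
      congr 1
      ext ω
      simp [hA, blockSum_eq_sum_shift]
    rw [hs, hs]
  simp_rw [key]
  refine tendsto_measure_zero_mono ((h n hn).tendsto_measure_lt hτ) ?_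
  filter_upwards [hτ.eventually_ge_atTop 0, hn.eventually_gt_atTop 0] with m hm hnm
  rintro ω ⟨l, hl, hτl⟩
  have hs : 0 < √(n m : ℝ) := Real.sqrt_pos.2 (by exact_mod_cast hnm)
  have hl0 : l ≠ 0 := by
    rintro rfl
    rw [blockSum_zero, abs_zero] at hτl
    exact hτl.not_ge (by simpa using (le_div_iff₀ hs).1 hm)
  have hmax := (lt_maxAbs_iff (n := n m) hm
    (f := fun l => (1 / √(n m : ℝ)) * blockSum (g m) (V m) (q m) l ω)).2 ?_
  · exact hmax.trans_le (le_abs_self _)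
  refine ⟨l, Finset.mem_Icc.2 ⟨Nat.one_le_iff_ne_zero.2 hl0, hl⟩, ?_⟩
  rw [abs_mul, abs_of_pos (one_div_pos.2 hs), one_div, inv_mul_eq_div]
  gcongr

/-! ### A maximal inequality of Rademacher–Menshov type -/

/-- The sum up to `l` is a sum of at most one dyadic block of each level, according to the binary
expansion of `l`. -/
lemma sq_sum_range_le_dyadic (x : ℕ → ℝ) {p l : ℕ} (hl : l < 2 ^ p) :
    (∑ j ∈ Finset.range l, x j) ^ 2 ≤ p * ∑ q ∈ Finset.range p, ∑ i ∈ Finset.range (2 ^ (p - q)),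
      (∑ j ∈ Finset.Ico (i * 2 ^ q) ((i + 1) * 2 ^ q), x j) ^ 2 := by
  set S : ℕ → ℝ := fun a => ∑ j ∈ Finset.range a, x j with hS
  have htel : ∑ q ∈ Finset.range p, (S (l / 2 ^ q * 2 ^ q) - S (l / 2 ^ (q + 1) * 2 ^ (q + 1))) =
      S l := by
    rw [Finset.sum_range_sub' (fun q => S (l / 2 ^ q * 2 ^ q))]
    simp [Nat.div_eq_of_lt hl, hS]
  change (S l) ^ 2 ≤ _
  rw [← htel]
  refine sq_sum_le_card_mul_sum_sq.trans ?_
  rw [Finset.card_range]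
  gcongr with q hq
  have hqp : q < p := Finset.mem_range.1 hq
  have hdiv : l / 2 ^ (q + 1) = l / 2 ^ q / 2 := by rw [pow_succ, Nat.div_div_eq_div_mul]
  have ha : l / 2 ^ q < 2 ^ (p - q) := by
    rw [Nat.div_lt_iff_lt_mul (by positivity), ← pow_add, Nat.sub_add_cancel hqp.le]
    exact hl
  rw [hdiv]
  set a := l / 2 ^ q
  rcases Nat.even_or_odd' a with ⟨b, hb | hb⟩
  · have : a / 2 * 2 ^ (q + 1) = a * 2 ^ q := by
      rw [hb, Nat.mul_div_cancel_left _ two_pos, pow_succ]; ring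
    rw [this, sub_self]
    simpa using Finset.sum_nonneg fun i _ => sq_nonneg _
  · have h2 : a / 2 * 2 ^ (q + 1) = (a - 1) * 2 ^ q := by
      have : a / 2 = b := by omega
      rw [this, hb, pow_succ, Nat.add_sub_cancel]; ring
    have h1 : a - 1 + 1 = a := by omega
    have h3 : S (a * 2 ^ q) - S ((a - 1) * 2 ^ q) =
        ∑ j ∈ Finset.Ico ((a - 1) * 2 ^ q) ((a - 1 + 1) * 2 ^ q), x j := by
      rw [Finset.sum_Ico_eq_sub _ (Nat.mul_le_mul_right _ (Nat.le_succ _))]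
      simp only [Nat.succ_eq_add_one, h1, hS]
    rw [h2, h3]
    exact Finset.single_le_sum
      (f := fun i => (∑ j ∈ Finset.Ico (i * 2 ^ q) ((i + 1) * 2 ^ q), x j) ^ 2)
      (fun i _ => sq_nonneg _) (Finset.mem_range.2 (by omega))

/-- If the second moments of the block sums are at most linear in the block length, then the
maximum of the partial sums is controlled up to a logarithmic factor. -/
lemma measure_exists_lt_abs_sum_range_le {x : ℕ → Ω → ℝ} (hx : ∀ j, Measurable (x j)) {u : ℝ}
    (h : ∀ a b, a < b → ∫⁻ ω, ENNReal.ofReal (|∑ j ∈ Finset.Ico a b, x j ω| ^ 2) ∂P ≤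
      ENNReal.ofReal (u * ((b : ℝ) - a))) (p : ℕ) {t : ℝ} (ht : 0 < t) :
    P {ω | ∃ l < 2 ^ p, t < |∑ j ∈ Finset.range l, x j ω|} ≤
      ENNReal.ofReal ((p : ℝ) ^ 2 * 2 ^ p * u / t ^ 2) := by
  set B : ℕ → ℕ → Ω → ℝ := fun q i ω => ∑ j ∈ Finset.Ico (i * 2 ^ q) ((i + 1) * 2 ^ q), x j ω
    with hB
  have hBm : ∀ q i, Measurable fun ω => ENNReal.ofReal (|B q i ω| ^ 2) := fun q i =>
    ((Finset.measurable_sum _ fun j _ => hx j).abs.pow_const 2).ennreal_ofReal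
  set f : Ω → ℝ≥0∞ := fun ω => (p : ℝ≥0∞) * ∑ q ∈ Finset.range p,
    ∑ i ∈ Finset.range (2 ^ (p - q)), ENNReal.ofReal (|B q i ω| ^ 2) with hf
  have hfm : Measurable f :=
    (Finset.measurable_sum _ fun q _ => Finset.measurable_sum _ fun i _ => hBm q i).const_mul _
  have hint : ∫⁻ ω, f ω ∂P ≤ ENNReal.ofReal ((p : ℝ) ^ 2 * 2 ^ p * u) := by
    rw [hf, lintegral_const_mul _ (Finset.measurable_sum _ fun q _ =>
      Finset.measurable_sum _ fun i _ => hBm q i),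
      lintegral_finsetSum _ (fun q _ => Finset.measurable_sum _ fun i _ => hBm q i)]
    calc (p : ℝ≥0∞) * ∑ q ∈ Finset.range p,
          ∫⁻ ω, ∑ i ∈ Finset.range (2 ^ (p - q)), ENNReal.ofReal (|B q i ω| ^ 2) ∂P
        ≤ (p : ℝ≥0∞) * ∑ q ∈ Finset.range p, ENNReal.ofReal (2 ^ p * u) := by
          gcongr with q hq
          rw [lintegral_finsetSum _ fun i _ => hBm q i]
          calc _ ≤ ∑ i ∈ Finset.range (2 ^ (p - q)), ENNReal.ofReal (u * 2 ^ q) := by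
                gcongr with i hi
                refine (h _ _ (Nat.mul_lt_mul_of_pos_right (Nat.lt_succ_self i)
                  (by positivity))).trans (le_of_eq ?_)
                congr 1
                push_cast
                ring
            _ = ENNReal.ofReal (2 ^ p * u) := by
                rw [Finset.sum_const, Finset.card_range, nsmul_eq_mul,
                  ← ENNReal.ofReal_natCast, ← ENNReal.ofReal_mul (by positivity)]
                congr 1
                push_cast
                rw [← Nat.sub_add_cancel (Finset.mem_range.1 hq).le, pow_add]
                simp only [Nat.sub_add_cancel (Finset.mem_range.1 hq).le]
                ring
      _ = ENNReal.ofReal ((p : ℝ) ^ 2 * 2 ^ p * u) := by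
          rw [Finset.sum_const, Finset.card_range, nsmul_eq_mul,
            ← ENNReal.ofReal_natCast, ← ENNReal.ofReal_mul (by positivity),
            ← ENNReal.ofReal_mul (by positivity)]
          congr 1
          ring
  have ht2 : 0 < t ^ 2 := by positivity
  rw [ENNReal.ofReal_div_of_pos ht2, ENNReal.le_div_iff_mul_le
    (Or.inl (by simpa using ht2.ne')) (Or.inl ENNReal.ofReal_ne_top), mul_comm]
  refine le_trans ?_ ((mul_meas_ge_le_lintegral hfm (ENNReal.ofReal (t ^ 2))).trans hint)
  refine mul_le_mul_right (measure_mono ?_) _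
  rintro ω ⟨l, hl, hlt⟩
  have h1 := sq_sum_range_le_dyadic (fun j => x j ω) hl
  have h2 : f ω = ENNReal.ofReal (p * ∑ q ∈ Finset.range p, ∑ i ∈ Finset.range (2 ^ (p - q)),
      (∑ j ∈ Finset.Ico (i * 2 ^ q) ((i + 1) * 2 ^ q), x j ω) ^ 2) := by
    rw [ENNReal.ofReal_mul (by positivity), ENNReal.ofReal_natCast,
      ENNReal.ofReal_sum_of_nonneg fun q _ => Finset.sum_nonneg fun i _ => sq_nonneg _]
    simp only [hf, hB, sq_abs]
    congr 1
    refine Finset.sum_congr rfl fun q _ => ?_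
    rw [ENNReal.ofReal_sum_of_nonneg fun i _ => sq_nonneg _]
  change _ ≤ f ω
  rw [h2]
  refine ENNReal.ofReal_le_ofReal (le_trans ?_ h1)
  rw [← sq_abs (∑ j ∈ Finset.range l, x j ω)]
  gcongr

/-! ### Conditional probabilities -/

/-- If the events `E m` agree, up to events of vanishing probability and up to small changes of
the level `x`, with `{T m ≤ x}`, where `T m` is independent of `𝓕 m`, then the conditional
probabilities of `E m` given `𝓕 m` converge to the limit of the distribution functions. -/
theorem tendstoInMeasure_condExp_of_sandwich [IsProbabilityMeasure P] {𝓕 : ℕ → MeasurableSpace Ω}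
    (h𝓕 : ∀ m, 𝓕 m ≤ ‹MeasurableSpace Ω›) {E : ℕ → Set Ω} (hE : ∀ m, MeasurableSet (E m))
    {T : ℕ → Ω → ℝ} (hT : ∀ m, Measurable (T m))
    (hind : ∀ m, Indep (MeasurableSpace.comap (T m) inferInstance) (𝓕 m) P) {F : ℝ → ℝ} {x : ℝ}
    (hF : ContinuousAt F x)
    (hTF : ∀ y, Tendsto (fun m => P.real {ω | T m ω ≤ y}) atTop (𝓝 (F y)))
    (hbad : ∀ δ > 0, ∃ B : ℕ → Set Ω, Tendsto (fun m => P (B m)) atTop (𝓝 0) ∧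
      ∀ᶠ m in atTop, ∀ ω ∉ B m, (ω ∈ E m → T m ω ≤ x + δ) ∧ (T m ω ≤ x - δ → ω ∈ E m)) :
    TendstoInMeasure P (fun m => P⟦E m | 𝓕 m⟧) atTop (fun _ => F x) := by
  rw [tendstoInMeasure_iff_measureReal_norm]
  intro ε hε
  obtain ⟨δ, hδ, hFδ⟩ := Metric.continuousAt_iff.1 hF (ε / 3) (by positivity)
  obtain ⟨B, hB0, hB⟩ := hbad (δ / 2) (by positivity)
  have hFp : |F (x + δ / 2) - F x| < ε / 3 := by
    refine hFδ ?_
    rw [Real.dist_eq, add_sub_cancel_left, abs_of_pos (by positivity)]; linarith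
  have hFm : |F (x - δ / 2) - F x| < ε / 3 := by
    refine hFδ ?_
    rw [Real.dist_eq, abs_sub_comm, sub_sub_cancel, abs_of_pos (by positivity)]; linarith
  -- the exceptional events are not assumed to be measurable
  set B' : ℕ → Set Ω := fun m => toMeasurable P (B m) with hB'
  have hB'm : ∀ m, MeasurableSet (B' m) := fun m => measurableSet_toMeasurable _ _
  have hB'0 : Tendsto (fun m => 3 / ε * P.real (B' m)) atTop (𝓝 0) := by
    have : Tendsto (fun m => P.real (B' m)) atTop (𝓝 0) := by
      simp only [Measure.real, hB', measure_toMeasurable]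
      exact (ENNReal.tendsto_toReal ENNReal.zero_ne_top).comp hB0
    simpa using this.const_mul (3 / ε)
  refine squeeze_zero' (Eventually.of_forall fun m => measureReal_nonneg) ?_ hB'0
  filter_upwards [hB, Metric.tendsto_nhds.1 (hTF (x + δ / 2)) (ε / 3) (by positivity),
    Metric.tendsto_nhds.1 (hTF (x - δ / 2)) (ε / 3) (by positivity)] with m hBm hp hm
  rw [Real.dist_eq] at hp hm
  have hTm : ∀ y, MeasurableSet {ω | T m ω ≤ y} := fun y => measurableSet_le (hT m)
    measurable_const
  have hint : ∀ {A : Set Ω}, MeasurableSet A → Integrable (A.indicator fun _ => (1 : ℝ)) P :=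
    fun hA => (integrable_const _).indicator hA
  have hconst : ∀ y, P⟦{ω | T m ω ≤ y} | 𝓕 m⟧ =ᵐ[P] fun _ => P.real {ω | T m ω ≤ y} := by
    intro y
    have hsm : StronglyMeasurable[MeasurableSpace.comap (T m) inferInstance]
        ({ω | T m ω ≤ y}.indicator fun _ => (1 : ℝ)) :=
      stronglyMeasurable_const.indicator ⟨Set.Iic y, measurableSet_Iic, rfl⟩
    have := condExp_indep_eq (hT m).comap_le (h𝓕 m) hsm (hind m)
    refine this.trans (Eventually.of_forall fun ω => ?_)
    simp only
    rw [integral_indicator (hTm y)]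
    simp
  have hup : P⟦E m | 𝓕 m⟧ ≤ᵐ[P]
      P[({ω | T m ω ≤ x + δ / 2}.indicator fun _ => (1 : ℝ)) +
        ((B' m).indicator fun _ => (1 : ℝ)) | 𝓕 m] := by
    refine condExp_mono (hint (hE m)) ((hint (hTm _)).add (hint (hB'm m)))
      (Eventually.of_forall fun ω => ?_)
    by_cases hω : ω ∈ B' m
    · simp only [Pi.add_apply, Set.indicator_of_mem hω]
      have h1 : (E m).indicator (fun _ => (1 : ℝ)) ω ≤ 1 :=
        Set.indicator_le_self' (fun _ _ => zero_le_one) ω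
      have h2 : 0 ≤ ({ω | T m ω ≤ x + δ / 2}.indicator fun _ => (1 : ℝ)) ω :=
        Set.indicator_nonneg (fun _ _ => zero_le_one) ω
      linarith
    · by_cases hωE : ω ∈ E m
      · have h2 := (hBm ω fun h => hω (subset_toMeasurable _ _ h)).1 hωE
        simp [Set.indicator_of_mem hωE, Set.indicator_of_notMem hω, h2]
      · rw [Set.indicator_of_notMem hωE]
        exact add_nonneg (Set.indicator_nonneg (fun _ _ => zero_le_one) ω)
          (Set.indicator_nonneg (fun _ _ => zero_le_one) ω)
  have hlo : P⟦{ω | T m ω ≤ x - δ / 2} | 𝓕 m⟧ ≤ᵐ[P]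
      P[((E m).indicator fun _ => (1 : ℝ)) + ((B' m).indicator fun _ => (1 : ℝ)) | 𝓕 m] := by
    refine condExp_mono (hint (hTm _)) ((hint (hE m)).add (hint (hB'm m)))
      (Eventually.of_forall fun ω => ?_)
    by_cases hω : ω ∈ B' m
    · simp only [Pi.add_apply, Set.indicator_of_mem hω]
      have h1 : ({ω | T m ω ≤ x - δ / 2}.indicator fun _ => (1 : ℝ)) ω ≤ 1 :=
        Set.indicator_le_self' (fun _ _ => zero_le_one) ω
      have h2 : 0 ≤ ((E m).indicator fun _ => (1 : ℝ)) ω :=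
        Set.indicator_nonneg (fun _ _ => zero_le_one) ω
      linarith
    · by_cases hωT : ω ∈ {ω | T m ω ≤ x - δ / 2}
      · have h2 := (hBm ω fun h => hω (subset_toMeasurable _ _ h)).2 hωT
        simp [Set.indicator_of_mem h2, Set.indicator_of_notMem hω, hωT.out]
      · rw [Set.indicator_of_notMem hωT]
        exact add_nonneg (Set.indicator_nonneg (fun _ _ => zero_le_one) ω)
          (Set.indicator_nonneg (fun _ _ => zero_le_one) ω)
  have hg0 : 0 ≤ᵐ[P] P⟦B' m | 𝓕 m⟧ :=
    condExp_nonneg (Eventually.of_forall fun ω => Set.indicator_nonneg (fun _ _ => zero_le_one) ω)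
  -- the conditional probability of `E m` is within `2 ε / 3` of `F x` up to that of `B m`
  have hsub : P.real {ω | ε ≤ ‖(P⟦E m | 𝓕 m⟧) ω - F x‖} ≤
      P.real {ω | ε / 3 ≤ (P⟦B' m | 𝓕 m⟧) ω} := by
    refine ENNReal.toReal_mono (measure_ne_top _ _) (measure_mono_ae ?_)
    filter_upwards [hup, hlo, hconst (x + δ / 2), hconst (x - δ / 2),
      condExp_add (hint (hTm (x + δ / 2))) (hint (hB'm m)) (𝓕 m),
      condExp_add (hint (hE m)) (hint (hB'm m)) (𝓕 m)] with ω h1 h2 h3 h4 h5 h6 h7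
    rw [h5, Pi.add_apply, h3] at h1
    rw [h6, Pi.add_apply, h4] at h2
    change ε ≤ _ at h7
    change ε / 3 ≤ _
    rw [Real.norm_eq_abs] at h7
    rw [abs_lt] at hp hm hFp hFm
    rcases le_abs.1 h7 with h8 | h8 <;> linarith [hp.1, hp.2, hm.1, hm.2, hFp.1, hFp.2, hFm.1, hFm.2]
  -- Markov's inequality
  refine hsub.trans ?_
  have := mul_meas_ge_le_integral_of_nonneg hg0 integrable_condExp (ε / 3)
  rw [integral_condExp (h𝓕 m), integral_indicator (hB'm m)] at this
  simp only [integral_const, MeasurableSet.univ, measureReal_restrict_apply, Set.univ_inter,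
    smul_eq_mul, mul_one] at this
  rw [div_mul_eq_mul_div, le_div_iff₀ hε]
  linarith

end General

end UStatMonitoring

namespace UStatMonitoring

/-! ### The time of the first crossing for a given noise path -/

section Crossing

variable {k : ℕ} {m c d q a₀ L₀ S S' ε a : ℝ}

/-- Up to relative errors of the order `ε`, the centering `a` is `a₀ = k + q m` and the delay
`a - k` is `L₀ = q (k + m)`. -/
lemma centering_estimates (hm : 0 < m) (hc : 0 < c) (hd : 0 < d) (hε : 0 < ε) (hε40 : ε ≤ 1 / 40)
    (hq_def : q = c / (√m * d)) (ha₀ : a₀ = k + q * m) (hL₀ : L₀ = q * (k + m))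
    (hq : q ≤ ε ^ 2) (hy : 1 / (√m * d) ≤ ε ^ 2) (hk : k / (c * (k + m)) ≤ ε ^ 2)
    (hS : |S| ≤ 1 / ε) (hS' : |S'| ≤ 1 / ε)
    (ha : a = (1 - c / (√m * d) + S' / (√m * d))⁻¹ *
      (k + k * ((S' - S) / (√m * d)) + c * √m / d)) :
    |1 - q + S' / (√m * d) - 1| ≤ 2 * ε ∧ |a - k - L₀| ≤ 4 * ε * L₀ ∧
      |√a / √a₀ - 1| ≤ 5 * ε ∧
      (1 - q + S' / (√m * d)) * a = k + k * ((S' - S) / (√m * d)) + q * m := by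
  set y := 1 / (√m * d) with hy_def
  have hy0 : 0 < y := by positivity
  have hqy : q = c * y := by rw [hq_def, hy_def]; ring
  have hq0 : 0 < q := by rw [hqy]; positivity
  have hk0 : (0 : ℝ) ≤ k := Nat.cast_nonneg k
  have hL0 : 0 < L₀ := by rw [hL₀]; positivity
  have ha0 : 0 < a₀ := by rw [ha₀]; positivity
  have hmul : ∀ z, |z| ≤ 1 / ε → |z * y| ≤ ε := by
    intro z hz
    rw [abs_mul, abs_of_pos hy0]
    calc |z| * y ≤ 1 / ε * ε ^ 2 := by gcongr
      _ = ε := by field_simp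
  have hS'y := hmul S' hS'
  have hSdiv : ∀ z, z / (√m * d) = z * y := fun z => by rw [hy_def]; ring
  have hcm : c * √m / d = q * m := by
    rw [hq_def]
    field_simp
    rw [Real.sq_sqrt hm.le]
  rw [hcm, hSdiv, hSdiv, hSdiv, ← hqy] at ha
  rw [hSdiv, hSdiv]
  set α := 1 - q + S' * y with hα
  have hε2 : ε ^ 2 ≤ ε / 40 := by nlinarith only [hε, hε40]
  have hα1 : |α - 1| ≤ 2 * ε := by
    rw [abs_le] at hS'y ⊢
    constructor <;> rw [hα] <;> linarith only [hS'y.1, hS'y.2, hq, hq0, hε2, hε]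
  have hα0 : 9 / 10 ≤ α := by linarith only [(abs_le.1 hα1).1, hε40]
  have hαa : α * a = k + k * ((S' - S) * y) + q * m := by
    rw [ha, mul_inv_cancel_left₀ (by linarith)]
  have hkS : |k * S * y| ≤ ε * L₀ := by
    have h1 : (k : ℝ) * y ≤ ε ^ 2 * L₀ := by
      have : (k : ℝ) * y = k / (c * (k + m)) * L₀ := by
        rw [hL₀, hqy]; field_simp
      rw [this]; gcongr
    have : (k : ℝ) * S * y = S * (k * y) := by ring
    rw [this, abs_mul, abs_of_nonneg (by positivity : (0 : ℝ) ≤ k * y)]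
    calc |S| * (k * y) ≤ 1 / ε * (ε ^ 2 * L₀) := by gcongr
      _ = ε * L₀ := by field_simp
  have hdelay : |a - k - L₀| ≤ 4 * ε * L₀ := by
    have h1 : α * (a - k - L₀) = - (k * S * y) - (α - 1) * L₀ := by
      have : α * k = k - q * k + k * (S' * y) := by rw [hα]; ring
      rw [mul_sub, mul_sub, hαa, this, hL₀]
      ring
    have h2 : |α * (a - k - L₀)| ≤ 3 * ε * L₀ := by
      rw [h1]
      calc |-(k * S * y) - (α - 1) * L₀| ≤ |-(k * S * y)| + |(α - 1) * L₀| := abs_sub _ _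
        _ ≤ ε * L₀ + 2 * ε * L₀ := by
            rw [abs_neg, abs_mul (α - 1), abs_of_pos hL0]; gcongr
        _ = 3 * ε * L₀ := by ring
    rw [abs_mul, abs_of_pos (by linarith)] at h2
    linarith only [h2, mul_le_mul_of_nonneg_right hα0 (abs_nonneg (a - k - L₀)), mul_pos hε hL0]
  refine ⟨hα1, hdelay, ?_, hαa⟩
  have hqk : q * k ≤ ε / 40 * a₀ := by
    have : (k : ℝ) ≤ a₀ := by rw [ha₀]; linarith only [mul_pos hq0 hm]
    exact mul_le_mul (hq.trans hε2) this hk0 (by positivity)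
  have hLa : L₀ ≤ a₀ := by
    rw [hL₀, ha₀]
    have : q * k ≤ 1 * k := by gcongr; linarith only [hq, hε2, hε40]
    linarith only [this]
  have hdiff : |a - a₀| ≤ 5 * ε * a₀ := by
    have h1 : a - a₀ = (a - k - L₀) + q * k := by rw [ha₀, hL₀]; ring
    have h2 : 4 * ε * L₀ ≤ 4 * ε * a₀ := by gcongr
    have h3 := mul_pos hε ha0
    have h4 : 0 ≤ q * k := by positivity
    rw [abs_le] at hdelay ⊢
    rw [h1]
    constructor <;> linarith only [hdelay.1, hdelay.2, h2, h3, h4, hqk]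
  rw [abs_le] at hdiff ⊢
  rw [← Real.sqrt_div' _ ha0.le]
  have h1 : 1 - 5 * ε ≤ a / a₀ := by rw [le_div_iff₀ ha0]; linarith only [hdiff.1]
  have h2 : a / a₀ ≤ 1 + 5 * ε := by rw [div_le_iff₀ ha0]; linarith only [hdiff.2]
  constructor
  · have : 1 - 5 * ε ≤ √(a / a₀) := by
      refine Real.le_sqrt_of_sq_le (le_trans ?_ h1)
      nlinarith only [hε, hε40]
    linarith only [this]
  · have : √(a / a₀) ≤ 1 + 5 * ε := by
      refine Real.sqrt_le_iff.2 ⟨by linarith only [hε], h2.trans ?_⟩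
      nlinarith only [hε, hε40]
    linarith only [this]

variable {x δ δ' T b b₀ : ℝ} {G V : ℕ → ℝ}

/-- The deterministic core of the argument: the signed detector is `G l` at time `k + l`, and it
exceeds the threshold `c (m + k + l) / √m` iff the drift `d (1 - q + S' / (√m d)) (k + l - a)`
together with the noise `V l` is positive. If the noise is `O(√a₀)` throughout and close to
`- T √a₀` at the times close to `a`, then a crossing before `a + x b` is almost the same as
`T ≤ x`. -/
theorem exists_crossing_sandwich (hm : 0 < m) (hc : 0 < c) (hd : 0 < d) (hε : 0 < ε)
    (hε40 : ε ≤ 1 / 40) (hεx : 2 * |x| * ε ≤ 1) (hεδ : 8 * ε * |x| + 2 * ε + δ' < δ)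
    (hq_def : q = c / (√m * d)) (ha₀ : a₀ = k + q * m) (hL₀ : L₀ = q * (k + m))
    (hb₀ : b₀ = √a₀ / d) (hb : b = √a / d)
    (hq : q ≤ ε ^ 2) (hy : 1 / (√m * d) ≤ ε ^ 2) (hk : k / (c * (k + m)) ≤ ε ^ 2)
    (hbL : b₀ ≤ ε ^ 2 * L₀) (hb1 : 1 ≤ ε * b₀)
    (hS : |S| ≤ 1 / ε) (hS' : |S'| ≤ 1 / ε)
    (ha : a = (1 - c / (√m * d) + S' / (√m * d))⁻¹ *
      (k + k * ((S' - S) / (√m * d)) + c * √m / d))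
    (hG : ∀ l, G l = k * (S / √m) + l * (d + S' / √m) + V l)
    (hV : ∀ l : ℕ, l ≤ 2 * L₀ → |V l| ≤ √a₀ / (4 * ε))
    (hVT : ∀ l : ℕ, |l - L₀| ≤ 20 * ε * L₀ → |V l + T * √a₀| ≤ δ' * √a₀) :
    0 < b ∧
    ((∃ l : ℕ, 0 < l ∧ k + l ≤ a + x * b ∧ c * (m + (k + l)) / √m < |G l|) → T ≤ x + δ) ∧
    (T ≤ x - δ → ∃ l : ℕ, 0 < l ∧ k + l ≤ a + x * b ∧ c * (m + (k + l)) / √m < |G l|) := by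
  obtain ⟨hα1, hdelay, hr, hαa⟩ :=
    centering_estimates hm hc hd hε hε40 hq_def ha₀ hL₀ hq hy hk hS hS' ha
  have hsm : 0 < √m := Real.sqrt_pos.2 hm
  have hk0 : (0 : ℝ) ≤ k := Nat.cast_nonneg k
  have hq0 : 0 < q := by rw [hq_def]; positivity
  have hL0 : 0 < L₀ := by rw [hL₀]; positivity
  have ha0 : 0 < a₀ := by rw [ha₀]; positivity
  have hsa : 0 < √a₀ := Real.sqrt_pos.2 ha0
  have hεL := mul_pos hε hL0
  set α := 1 - q + S' / (√m * d) with hα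
  set r := √a / √a₀ with hr_def
  have hrange : 1 - 5 * ε ≤ r ∧ r ≤ 1 + 5 * ε := by
    rw [abs_le] at hr; constructor <;> linarith only [hr.1, hr.2]
  have hαrange : 1 - 2 * ε ≤ α ∧ α ≤ 1 + 2 * ε := by
    rw [abs_le] at hα1; constructor <;> linarith only [hα1.1, hα1.2]
  have hbr : b = r * b₀ := by rw [hb, hr_def, hb₀]; field_simp
  have hb₀d : b₀ * d = √a₀ := by rw [hb₀]; field_simp
  have hb₀0 : 0 < b₀ := by rw [hb₀]; positivity
  have hb0 : 0 < b := by rw [hbr]; exact mul_pos (by linarith only [hrange.1, hε40]) hb₀0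
  have hαr : |α * r - 1| ≤ 8 * ε := by
    have h1 : α * r - 1 = (α - 1) * (r - 1) + (α - 1) + (r - 1) := by ring
    have h2 : |(α - 1) * (r - 1)| ≤ 2 * ε * (5 * ε) := by rw [abs_mul]; gcongr
    rw [h1]
    calc _ ≤ |(α - 1) * (r - 1)| + |α - 1| + |r - 1| := abs_add_three _ _ _
      _ ≤ 2 * ε * (5 * ε) + 2 * ε + 5 * ε := by gcongr
      _ ≤ 8 * ε := by linarith only [hε, mul_le_mul_of_nonneg_left hε40 hε.le]
  have hαrx : |x * (α * r) - x| ≤ 8 * ε * |x| := by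
    have : x * (α * r) - x = (α * r - 1) * x := by ring
    rw [this, abs_mul]; gcongr
  have hxb : |x * b| ≤ ε * L₀ := by
    rw [hbr, abs_mul, abs_mul, abs_of_pos hb₀0, abs_of_nonneg (by linarith only [hrange.1, hε40] : 0 ≤ r)]
    calc |x| * (r * b₀) ≤ |x| * (2 * (ε ^ 2 * L₀)) := by
          gcongr; linarith only [hrange.2, hε40]
      _ = (2 * |x| * ε) * (ε * L₀) := by ring
      _ ≤ 1 * (ε * L₀) := by gcongr
      _ = ε * L₀ := one_mul _
  have htime : |a + x * b - k - L₀| ≤ 5 * ε * L₀ := by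
    have : a + x * b - k - L₀ = (a - k - L₀) + x * b := by ring
    rw [this]
    calc _ ≤ |a - k - L₀| + |x * b| := abs_add_le _ _
      _ ≤ 4 * ε * L₀ + ε * L₀ := by gcongr
      _ = _ := by ring
  have h1L : 1 ≤ ε * L₀ := by
    calc 1 ≤ ε * b₀ := hb1
      _ ≤ ε * (ε ^ 2 * L₀) := by gcongr
      _ = ε ^ 2 * (ε * L₀) := by ring
      _ ≤ 1 * (ε * L₀) := by gcongr; exact pow_le_one₀ hε.le (by linarith only [hε40])
      _ = _ := one_mul _
  have hdε : d ≤ ε * √a₀ := by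
    calc d = 1 * d := (one_mul d).symm
      _ ≤ ε * b₀ * d := by gcongr
      _ = _ := by rw [mul_assoc, hb₀d]
  -- the detector minus the threshold is the linear drift, which vanishes at `a`, plus the noise
  have hdrift : ∀ l : ℕ, G l - c * (m + (k + l)) / √m = α * d * (k + l - a) + V l := by
    intro l
    have h1 : α * d * (k + l - a) = d * (α * (k + l)) - d * (α * a) := by ring
    have h2 : c / √m = q * d := by rw [hq_def]; field_simp
    have h3 : ∀ z, z / √m = z / (√m * d) * d := fun z => by field_simp
    rw [hG, h1, hαa, hα, mul_comm c, mul_div_assoc, h2, h3 S, h3 S', sub_div]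
    ring
  refine ⟨hb0, ?_, ?_⟩
  · rintro ⟨l, hl0, hla, hcross⟩
    have hl2 : (l : ℝ) ≤ (1 + 5 * ε) * L₀ := by
      linarith only [(abs_le.1 htime).2, hla]
    have hVl := hV l (hl2.trans (by gcongr; linarith only [hε40]))
    -- the detector cannot cross the threshold with the wrong sign
    have hneg : - (c * (m + (k + l)) / √m) ≤ G l := by
      have hS'd : 0 ≤ d + S' / √m := by
        have : d + S' / √m = d * (1 + S' / (√m * d)) := by field_simp
        rw [this]
        have : 0 ≤ 1 + S' / (√m * d) := by
          have : 0 ≤ α := by linarith only [hαrange.1, hε40]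
          rw [hα] at this
          linarith only [this, hq0]
        positivity
      have hkS : -(ε * (c * (k + m) / √m)) ≤ k * (S / √m) := by
        have h1 : (k : ℝ) ≤ ε ^ 2 * (c * (k + m)) := (div_le_iff₀ (by positivity)).1 hk
        have h2 : |k * (S / √m)| ≤ ε * (c * (k + m) / √m) := by
          rw [abs_mul, abs_div, abs_of_nonneg hk0, abs_of_pos hsm]
          calc (k : ℝ) * (|S| / √m) ≤ ε ^ 2 * (c * (k + m)) * (1 / ε / √m) := by gcongr
            _ = _ := by field_simp
        linarith only [(abs_le.1 h2).1]
      have hVε : -(ε * (c * (k + m) / √m)) ≤ V l := by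
        have h1 : √a₀ ≤ ε ^ 2 * (c * (k + m) / √m) := by
          calc √a₀ = b₀ * d := hb₀d.symm
            _ ≤ ε ^ 2 * L₀ * d := by gcongr
            _ = _ := by rw [hL₀, hq_def]; field_simp
        have h2 : √a₀ / (4 * ε) ≤ ε * (c * (k + m) / √m) := by
          rw [div_le_iff₀ (by positivity)]
          have : 0 < ε ^ 2 * (c * (k + m) / √m) := by positivity
          linarith only [h1, this,
            show ε * (c * (k + m) / √m) * (4 * ε) = 4 * (ε ^ 2 * (c * (k + m) / √m)) by ring]
        linarith only [(abs_le.1 hVl).1, h2]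
      have hth : c * (k + m) / √m ≤ c * (m + (k + l)) / √m := by
        gcongr ?_ / _
        linarith only [mul_nonneg hc.le (Nat.cast_nonneg (α := ℝ) l)]
      have hpos : 0 < c * (k + m) / √m := by positivity
      have hll : 0 ≤ l * (d + S' / √m) := by positivity
      have h2ε : ε * (c * (k + m) / √m) ≤ 1 / 40 * (c * (k + m) / √m) := by gcongr
      rw [hG]
      linarith only [hkS, hVε, hth, hpos, hll, h2ε]
    have hpos : 0 < α * d * (k + l - a) + V l := by
      rw [← hdrift]
      rcases lt_abs.1 hcross with h | h <;> linarith only [h, hneg]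
    rcases le_or_gt (L₀ - 20 * ε * L₀) l with hl | hl
    · have h1 := (abs_le.1 (hVT l (abs_le.2 ⟨by linarith only [hl],
        by linarith only [hl2, hεL]⟩))).2
      have h2 : α * d * (k + l - a) ≤ α * d * (x * b) := by
        have : 0 ≤ α * d := mul_nonneg (by linarith only [hαrange.1, hε40]) hd.le
        exact mul_le_mul_of_nonneg_left (by linarith only [hla]) this
      have h3 : α * d * (x * b) = x * (α * r) * √a₀ := by rw [hbr, ← hb₀d]; ring
      have h4 : 0 < (x * (α * r) - T + δ') * √a₀ := by
        have : (x * (α * r) - T + δ') * √a₀ = x * (α * r) * √a₀ - T * √a₀ + δ' * √a₀ := by ring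
        linarith only [this, h1, h2, h3, hpos]
      have h5 := (pos_iff_pos_of_mul_pos h4).2 hsa
      linarith only [h5, (abs_le.1 hαrx).2, hεδ, hε]
    · -- long before `a`, the drift is too negative for the noise
      exfalso
      have h1 : (k : ℝ) + l - a ≤ -(16 * (ε * L₀)) := by
        linarith only [(abs_le.1 hdelay).1, hl]
      have h2 : α * d * (k + l - a) ≤ -(8 * (ε * L₀) * d) := by
        have h3 : d / 2 ≤ α * d := by nlinarith only [hαrange.1, hd, hε40]
        calc α * d * (k + l - a) ≤ α * d * (-(16 * (ε * L₀))) :=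
                mul_le_mul_of_nonneg_left h1 (by linarith)
          _ = -(α * d * (16 * (ε * L₀))) := by ring
          _ ≤ -(d / 2 * (16 * (ε * L₀))) := by gcongr
          _ = _ := by ring
      have h3 : √a₀ ≤ ε ^ 2 * L₀ * d := by rw [← hb₀d]; gcongr
      have h4 : √a₀ / (4 * ε) ≤ ε * L₀ * d := by
        rw [div_le_iff₀ (by positivity)]
        have : 0 < ε ^ 2 * L₀ * d := by positivity
        linarith only [h3, this, show ε * L₀ * d * (4 * ε) = 4 * (ε ^ 2 * L₀ * d) by ring]
      have h5 : 0 < ε * L₀ * d := by positivity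
      linarith only [(abs_le.1 hVl).2, hpos, h2, h4, h5]
  · intro hT
    have hlow := (abs_le.1 htime).1
    have hhigh := (abs_le.1 htime).2
    have hε40L := mul_le_mul_of_nonneg_right hε40 hL0.le
    have hnn : 0 ≤ a + x * b - k := by linarith only [hlow, hε40L, hL0]
    refine ⟨⌊a + x * b - k⌋₊, ?_, ?_, ?_⟩
    · exact Nat.floor_pos.2 (by linarith only [hlow, hε40L, hL0, h1L])
    · linarith only [Nat.floor_le hnn]
    · set l := ⌊a + x * b - k⌋₊
      have hl1 : (l : ℝ) ≤ a + x * b - k := Nat.floor_le hnn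
      have hl2 : a + x * b - k < l + 1 := Nat.lt_floor_add_one _
      have h1 := (abs_le.1 (hVT l (abs_le.2 ⟨by linarith, by linarith⟩))).1
      have h2 : α * d * (x * b - 1) ≤ α * d * (k + l - a) := by
        have : 0 ≤ α * d := mul_nonneg (by linarith only [hαrange.1, hε40]) hd.le
        exact mul_le_mul_of_nonneg_left (by linarith only [hl2]) this
      have h3 : α * d * (x * b - 1) = x * (α * r) * √a₀ - α * d := by rw [hbr, ← hb₀d]; ring
      have h4 : α * d ≤ 2 * ε * √a₀ := by
        calc α * d ≤ 2 * (ε * √a₀) := by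
              have : α ≤ 2 := by linarith only [hαrange.2, hε40]
              gcongr
          _ = _ := by ring
      have h5 : 0 < (x * (α * r) - 2 * ε - T - δ') * √a₀ :=
        mul_pos (by linarith only [hT, hεδ, (abs_le.1 hαrx).1]) hsa
      have h6 : 0 < G l - c * (m + (k + l)) / √m := by
        have : (x * (α * r) - 2 * ε - T - δ') * √a₀ =
            x * (α * r) * √a₀ - 2 * ε * √a₀ - T * √a₀ - δ' * √a₀ := by ring
        rw [hdrift]
        linarith only [this, h1, h2, h3, h4, h5]
      exact (sub_pos.1 h6).trans_le (le_abs_self _)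

end Crossing

end UStatMonitoring

namespace UStatMonitoring

namespace Model

/-! ### Deterministic asymptotics of the standardizing sequences -/

section Asymptotics

variable {Ω : Type*} [MeasurableSpace Ω] (M : Model Ω) (P : Measure Ω)

/-- `c_m / (√m |Δ_m|)`, the ratio of the slopes of the threshold and of the detector. -/
noncomputable def slopeRatio (m : ℕ) : ℝ := M.c m / (√(m : ℝ) * |M.Delta P m|)

/-- The deterministic first order approximation `k* + c_m √m / |Δ_m|` of `a_m`. -/
noncomputable def approxTime (m : ℕ) : ℝ := M.kstar m + M.slopeRatio P m * m

/-- The deterministic first order approximation of `a_m - k*`. -/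
noncomputable def approxDelay (m : ℕ) : ℝ := M.slopeRatio P m * (M.kstar m + m)

/-- The deterministic first order approximation of `b_m`. -/
noncomputable def approxScale (m : ℕ) : ℝ := √(M.approxTime P m) / |M.Delta P m|

/-- A null sequence `ε_m` for which `ε_m²` bounds all the relative errors of the deterministic
approximations, while `1 / ε_m` is at most `approxScale`. Then quantities that are bounded in
probability are eventually below `1 / ε_m` with high probability, and the product of the two bounds
is still small. -/
noncomputable def errorRate (m : ℕ) : ℝ :=
  √(M.slopeRatio P m + 1 / (√(m : ℝ) * |M.Delta P m|) +
    M.kstar m / (M.c m * (M.kstar m + m)) + M.approxScale P m / M.approxDelay P m) +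
  1 / M.approxScale P m

variable {M P}

lemma kstar_le (h : M.Setting P) (m : ℕ) : (M.kstar m : ℝ) ≤ M.lam * (m : ℝ) ^ M.beta :=
  Nat.floor_le (mul_nonneg h.lam_pos.le (Real.rpow_nonneg (Nat.cast_nonneg m) _))

lemma eventually_pos (hC : M.ChangeSize P) (hT : M.Threshold P) :
    ∀ᶠ m : ℕ in atTop, 0 < (m : ℝ) ∧ 0 < M.c m ∧ 0 < |M.Delta P m| := by
  obtain ⟨ε₀, hε₀, hc⟩ := hT.liminf_pos
  filter_upwards [hc, hC.detectable.eventually_gt_atTop 0, eventually_gt_atTop 0] with m h1 h2 h3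
  refine ⟨by exact_mod_cast h3, by linarith, ?_⟩
  rcases (abs_nonneg (M.Delta P m)).eq_or_lt with h | h
  · rw [← h] at h2; simp at h2
  · exact h

lemma tendsto_slopeRatio (hC : M.ChangeSize P) : Tendsto (M.slopeRatio P) atTop (𝓝 0) := by
  refine hC.detectable.inv_tendsto_atTop.congr fun m => ?_
  simp [slopeRatio]

lemma tendsto_inv_sqrt_mul_Delta (hC : M.ChangeSize P) (hT : M.Threshold P) :
    Tendsto (fun m : ℕ => 1 / (√(m : ℝ) * |M.Delta P m|)) atTop (𝓝 0) := by
  obtain ⟨ε₀, hε₀, hc⟩ := hT.liminf_pos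
  refine squeeze_zero' (g := fun m => 1 / ε₀ * M.slopeRatio P m)
    (Eventually.of_forall fun m => by positivity) ?_
    (by simpa using (tendsto_slopeRatio hC).const_mul (1 / ε₀))
  filter_upwards [hc, eventually_pos hC hT] with m h1 ⟨h2, h3, h4⟩
  have : 0 < √(m : ℝ) := Real.sqrt_pos.2 h2
  rw [slopeRatio, div_mul_div_comm, div_le_div_iff₀ (by positivity) (by positivity)]
  nlinarith [mul_pos this h4]

/-- This is where the growth condition on the threshold is used: the historic noise
`k* S_{1,m} / √m` is negligible compared with the threshold `c_m (k* + m) / √m`. -/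
lemma tendsto_kstar_div (hS : M.Setting P) (hC : M.ChangeSize P) (hT : M.Threshold P) :
    Tendsto (fun m : ℕ => M.kstar m / (M.c m * (M.kstar m + m))) atTop (𝓝 0) := by
  set κ := min 1 (1 / M.lam) with hκ
  have hlam := hS.lam_pos
  have hκ0 : 0 < κ := by positivity
  refine squeeze_zero' (g := fun m => (κ * (M.c m * max 1 ((m : ℝ) ^ (1 - M.beta))))⁻¹) ?_ ?_
    (hT.growth.const_mul_atTop hκ0).inv_tendsto_atTop
  · filter_upwards [eventually_pos hC hT] with m ⟨h1, h2, _⟩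
    positivity
  · filter_upwards [eventually_pos hC hT] with m ⟨h1, h2, _⟩
    rw [← one_div, div_le_div_iff₀ (by positivity) (by positivity), one_mul]
    have key : M.kstar m * (κ * max 1 ((m : ℝ) ^ (1 - M.beta))) ≤ M.kstar m + m := by
      rcases max_cases (1 : ℝ) ((m : ℝ) ^ (1 - M.beta)) with ⟨h, _⟩ | ⟨h, _⟩ <;> rw [h]
      · have : κ ≤ 1 := min_le_left _ _
        nlinarith
      · have h3 : κ ≤ 1 / M.lam := min_le_right _ _
        calc M.kstar m * (κ * (m : ℝ) ^ (1 - M.beta))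
            ≤ M.lam * (m : ℝ) ^ M.beta * (1 / M.lam * (m : ℝ) ^ (1 - M.beta)) := by
              gcongr; exact kstar_le hS m
          _ = (m : ℝ) ^ M.beta * (m : ℝ) ^ (1 - M.beta) := by field_simp
          _ = m := by rw [← Real.rpow_add h1]; simp
          _ ≤ _ := by linarith
    calc _ = M.c m * (M.kstar m * (κ * max 1 ((m : ℝ) ^ (1 - M.beta)))) := by ring
      _ ≤ _ := by gcongr

lemma tendsto_slopeRatio_mul (hC : M.ChangeSize P) (hT : M.Threshold P) :
    Tendsto (fun m : ℕ => M.slopeRatio P m * m) atTop atTop := by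
  obtain ⟨ε₀, hε₀, hc⟩ := hT.liminf_pos
  obtain ⟨C, hCb⟩ := hC.bounded
  have h1 : Tendsto (fun m : ℕ => ε₀ / max C 1 * √(m : ℝ)) atTop atTop :=
    (Real.tendsto_sqrt_atTop.comp tendsto_natCast_atTop_atTop).const_mul_atTop (by positivity)
  refine tendsto_atTop_mono' _ ?_ h1
  filter_upwards [hc, hCb, eventually_pos hC hT] with m h1 h2 ⟨h3, h4, h5⟩
  have : M.slopeRatio P m * m = M.c m / |M.Delta P m| * √(m : ℝ) := by
    rw [slopeRatio]
    nth_rw 2 [← Real.mul_self_sqrt h3.le]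
    field_simp
  rw [this]
  gcongr
  exact h2.trans (le_max_left _ _)

lemma slopeRatio_mul_le_approxTime (m : ℕ) : M.slopeRatio P m * m ≤ M.approxTime P m := by
  rw [approxTime]
  linarith [(Nat.cast_nonneg (M.kstar m) : (0 : ℝ) ≤ _)]

lemma tendsto_approxTime (hC : M.ChangeSize P) (hT : M.Threshold P) :
    Tendsto (M.approxTime P) atTop atTop :=
  tendsto_atTop_mono slopeRatio_mul_le_approxTime (tendsto_slopeRatio_mul hC hT)

lemma tendsto_approxScale (hC : M.ChangeSize P) (hT : M.Threshold P) :
    Tendsto (M.approxScale P) atTop atTop := by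
  obtain ⟨C, hCb⟩ := hC.bounded
  have hC' : 0 < max C 1 := by positivity
  refine tendsto_atTop_mono' _ ?_
    ((Real.tendsto_sqrt_atTop.comp (tendsto_approxTime hC hT)).atTop_div_const hC')
  filter_upwards [hCb, eventually_pos hC hT] with m h2 ⟨h3, h4, h5⟩
  simp only [Function.comp_apply, approxScale]
  gcongr
  exact h2.trans (le_max_left _ _)

lemma approx_pos (hC : M.ChangeSize P) (hT : M.Threshold P) : ∀ᶠ m : ℕ in atTop,
    0 < M.slopeRatio P m ∧ 0 < M.approxTime P m ∧ 0 < M.approxDelay P m ∧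
      0 < M.approxScale P m := by
  filter_upwards [eventually_pos hC hT] with m ⟨h1, h2, h3⟩
  have hq : 0 < M.slopeRatio P m := by rw [slopeRatio]; positivity
  have ha : 0 < M.approxTime P m := by rw [approxTime]; positivity
  refine ⟨hq, ha, ?_, ?_⟩
  · rw [approxDelay]; positivity
  · rw [approxScale]; positivity

/-- The random fluctuation of the delay time is of smaller order than the delay itself. -/
lemma tendsto_approxScale_div_approxDelay (hS : M.Setting P) (hC : M.ChangeSize P)
    (hT : M.Threshold P) :
    Tendsto (fun m => M.approxScale P m / M.approxDelay P m) atTop (𝓝 0) := by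
  obtain ⟨ε₀, hε₀, hc⟩ := hT.liminf_pos
  have hlim : Tendsto (fun m : ℕ => √(1 / ε₀ * (M.kstar m / (M.c m * (M.kstar m + m))) +
      1 / ε₀ ^ 2 * M.slopeRatio P m)) atTop (𝓝 0) := by
    have := (((tendsto_kstar_div hS hC hT).const_mul (1 / ε₀)).add
      ((tendsto_slopeRatio hC).const_mul (1 / ε₀ ^ 2))).sqrt
    simpa using this
  refine squeeze_zero' ?_ ?_ hlim
  · filter_upwards [approx_pos hC hT] with m ⟨_, _, h3, h4⟩
    positivity
  · filter_upwards [hc, eventually_pos hC hT, approx_pos hC hT] with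
      m h1 ⟨h2, h3, h4⟩ ⟨h5, h6, h7, h8⟩
    refine Real.le_sqrt_of_sq_le ?_
    set q := M.slopeRatio P m with hq
    set k : ℝ := (M.kstar m : ℝ) with hk
    have hmain : (M.approxScale P m / M.approxDelay P m) ^ 2 =
        (k + q * m) * m / (M.c m * (k + m)) ^ 2 := by
      rw [approxScale, approxDelay, div_div, div_pow, Real.sq_sqrt h6.le]
      have : (|M.Delta P m| * (q * (k + m))) ^ 2 * m = (M.c m * (k + m)) ^ 2 := by
        have h9 : |M.Delta P m| * q * √(m : ℝ) = M.c m := by rw [hq, slopeRatio]; field_simp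
        calc _ = (|M.Delta P m| * q * √(m : ℝ) * (k + m)) ^ 2 := by
              rw [mul_pow _ (k + (m : ℝ)), mul_pow _ (√(m : ℝ)), Real.sq_sqrt h2.le]; ring
          _ = _ := by rw [h9]
      rw [approxTime, ← hk, ← hq, ← this]
      field_simp
    rw [hmain]
    have e1 : (k + q * m) * m / (M.c m * (k + m)) ^ 2 =
        m / (M.c m * (k + m)) * (k / (M.c m * (k + m))) +
          (m / (M.c m * (k + m))) ^ 2 * q := by
      field_simp
    have e2 : m / (M.c m * (k + m)) ≤ 1 / ε₀ := by
      rw [div_le_div_iff₀ (by positivity) hε₀]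
      nlinarith
    have e3 : (m / (M.c m * (k + m))) ^ 2 ≤ 1 / ε₀ ^ 2 := by
      calc _ ≤ (1 / ε₀) ^ 2 := by gcongr
        _ = _ := by rw [div_pow, one_pow]
    rw [e1]
    gcongr

lemma tendsto_errorRate (hS : M.Setting P) (hC : M.ChangeSize P) (hT : M.Threshold P) :
    Tendsto (M.errorRate P) atTop (𝓝 0) := by
  have h1 := ((((tendsto_slopeRatio hC).add (tendsto_inv_sqrt_mul_Delta hC hT)).add
    (tendsto_kstar_div hS hC hT)).add (tendsto_approxScale_div_approxDelay hS hC hT)).sqrt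
  have h2 := (tendsto_approxScale hC hT).inv_tendsto_atTop
  have := h1.add h2
  change Tendsto (fun m => M.errorRate P m) atTop (𝓝 0)
  simpa [errorRate, Function.comp_def] using this

lemma errorRate_spec (hC : M.ChangeSize P) (hT : M.Threshold P) : ∀ᶠ m : ℕ in atTop,
    0 < M.errorRate P m ∧ M.slopeRatio P m ≤ M.errorRate P m ^ 2 ∧
      1 / (√(m : ℝ) * |M.Delta P m|) ≤ M.errorRate P m ^ 2 ∧
      M.kstar m / (M.c m * (M.kstar m + m)) ≤ M.errorRate P m ^ 2 ∧
      M.approxScale P m ≤ M.errorRate P m ^ 2 * M.approxDelay P m ∧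
      1 ≤ M.errorRate P m * M.approxScale P m := by
  filter_upwards [eventually_pos hC hT, approx_pos hC hT] with m ⟨h2, h3, h4⟩ ⟨h5, h6, h7, h8⟩
  have e1 : 0 < 1 / (√(m : ℝ) * |M.Delta P m|) := by positivity
  have e2 : 0 ≤ M.kstar m / (M.c m * (M.kstar m + m)) := by positivity
  have e3 : 0 < M.approxScale P m / M.approxDelay P m := by positivity
  have e4 : 0 < 1 / M.approxScale P m := by positivity
  set s := M.slopeRatio P m + 1 / (√(m : ℝ) * |M.Delta P m|) +
    M.kstar m / (M.c m * (M.kstar m + m)) + M.approxScale P m / M.approxDelay P m with hs_def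
  have hs0 : 0 < s := by positivity
  have hε : M.errorRate P m = √s + 1 / M.approxScale P m := rfl
  have hsq : s ≤ M.errorRate P m ^ 2 := by
    rw [hε, add_sq, Real.sq_sqrt hs0.le]
    nlinarith [mul_nonneg (Real.sqrt_nonneg s) e4.le, sq_nonneg (1 / M.approxScale P m)]
  refine ⟨by rw [hε]; positivity, by linarith, by linarith, by linarith, ?_, ?_⟩
  · rw [← div_le_iff₀ h7]; linarith
  · rw [← div_le_iff₀ h8, hε]; linarith [Real.sqrt_nonneg s]

/-- The error rate is so slow that `errorRate * approxDelay` still tends to infinity. -/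
lemma tendsto_errorRate_mul_approxDelay (hS : M.Setting P) (hC : M.ChangeSize P)
    (hT : M.Threshold P) :
    Tendsto (fun m => M.errorRate P m * M.approxDelay P m) atTop atTop := by
  refine tendsto_atTop_mono' _ ?_ (tendsto_approxScale hC hT)
  filter_upwards [errorRate_spec hC hT, approx_pos hC hT,
    (tendsto_errorRate hS hC hT).eventually_le_const zero_lt_one] with
    m ⟨h1, _, _, _, h2, _⟩ ⟨_, _, h3, _⟩ h4
  refine h2.trans ?_
  gcongr
  exact pow_le_of_le_one h1.le h4 two_ne_zero

lemma approxDelay_le_approxTime (hC : M.ChangeSize P) :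
    ∀ᶠ m : ℕ in atTop, M.approxDelay P m ≤ M.approxTime P m := by
  filter_upwards [(tendsto_slopeRatio hC).eventually_le_const zero_lt_one] with m h
  rw [approxDelay, approxTime, mul_add]
  gcongr
  exact mul_le_of_le_one_left (Nat.cast_nonneg _) h

end Asymptotics

end Model

end UStatMonitoring

namespace UStatMonitoring

/-- A version of `BlockMaximaBounded` for real bounds on the block lengths. -/
lemma BlockMaximaBounded.tendsto_measure {Ω E : Type*} [MeasurableSpace Ω] {P : Measure Ω}
    {g : ℕ → E → ℝ} {V : ℕ → ℤ → Ω → E} (h : BlockMaximaBounded P g V) {N : ℕ → ℝ}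
    (hN : Tendsto N atTop atTop) (p : ℕ → ℕ) {τ : ℕ → ℝ}
    (hτ : Tendsto (fun m => τ m / √(N m)) atTop atTop) :
    Tendsto (fun m => P {ω | ∃ l : ℕ, (l : ℝ) ≤ N m ∧ τ m < |blockSum (g m) (V m) (p m) l ω|})
      atTop (𝓝 0) := by
  refine tendsto_measure_zero_mono (h (fun m => ⌈N m⌉₊) p (tendsto_nat_ceil_atTop.comp hN) τ ?_)
    (Eventually.of_forall fun m => ?_)
  · refine tendsto_atTop_mono' _ ?_ (hτ.atTop_div_const (Real.sqrt_pos.2 two_pos))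
    filter_upwards [hτ.eventually_ge_atTop 0, hN.eventually_ge_atTop 1] with m h1 h2
    have hN0 : 0 < N m := by linarith
    have h3 : 0 ≤ τ m := by simpa using (le_div_iff₀ (Real.sqrt_pos.2 hN0)).1 h1
    have hc : 0 < (⌈N m⌉₊ : ℝ) := hN0.trans_le (Nat.le_ceil _)
    rw [div_div, ← Real.sqrt_mul hN0.le]
    have : (⌈N m⌉₊ : ℝ) ≤ N m * 2 := by linarith [Nat.ceil_lt_add_one hN0.le]
    gcongr
  · rintro ω ⟨l, hl, hlt⟩
    exact ⟨l, by exact_mod_cast hl.trans (Nat.le_ceil _), hlt⟩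

/-- Chebyshev's inequality for a second moment given as a Lebesgue integral. -/
lemma measure_lt_abs_le {Ω : Type*} [MeasurableSpace Ω] {P : Measure Ω} {f : Ω → ℝ}
    (hf : Measurable f) {B : ℝ}
    (h : ∫⁻ ω, ENNReal.ofReal (|f ω| ^ 2) ∂P ≤ ENNReal.ofReal B) {t : ℝ} (ht : 0 < t) :
    P {ω | t < |f ω|} ≤ ENNReal.ofReal (B / t ^ 2) := by
  have ht2 : 0 < t ^ 2 := by positivity
  rw [ENNReal.ofReal_div_of_pos ht2, ENNReal.le_div_iff_mul_le
    (Or.inl (by simpa using ht2.ne')) (Or.inl ENNReal.ofReal_ne_top), mul_comm]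
  refine le_trans ?_ ((mul_meas_ge_le_lintegral (hf.abs.pow_const 2).ennreal_ofReal
    (ENNReal.ofReal (t ^ 2))).trans h)
  refine mul_le_mul_right (measure_mono ?_) _
  intro ω (hω : t < |f ω|)
  refine ENNReal.ofReal_le_ofReal ?_
  gcongr

namespace Model

variable {Ω : Type*} [MeasurableSpace Ω] {P : Measure Ω} {M : Model Ω}

/-! ### Measurability -/

section Measurability

variable [IsProbabilityMeasure P]

lemma measurable_h_comp {α : Type*} [MeasurableSpace α] (hS : M.Setting P) {f g : α → ℝ}
    (hf : Measurable f) (hg : Measurable g) : Measurable fun x => M.h (f x) (g x) :=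
  hS.measurable_h.comp (hf.prodMk hg)

lemma measurable_h1 (hS : M.Setting P) : Measurable (M.h1 P) := by
  have : Measurable fun p : ℝ × Ω => M.h p.1 (M.Y 1 p.2) - M.theta P :=
    (measurable_h_comp hS measurable_fst ((hS.measurable_Y 1).comp measurable_snd)).sub_const _
  exact this.stronglyMeasurable.integral_prod_right'.measurable

lemma measurable_h1Star (hS : M.Setting P) (m : ℕ) : Measurable (M.h1Star P m) := by
  have : Measurable fun p : ℝ × Ω => M.h p.1 (M.Z m 1 p.2) - M.thetaStar P m :=
    (measurable_h_comp hS measurable_fst ((hS.measurable_Z m 1).comp measurable_snd)).sub_const _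
  exact this.stronglyMeasurable.integral_prod_right'.measurable

lemma measurable_h2 (hS : M.Setting P) : Measurable (M.h2 P) := by
  have : Measurable fun p : ℝ × Ω => M.h (M.Y 1 p.2) p.1 - M.theta P :=
    (measurable_h_comp hS ((hS.measurable_Y 1).comp measurable_snd) measurable_fst).sub_const _
  exact this.stronglyMeasurable.integral_prod_right'.measurable

lemma measurable_h2Star (hS : M.Setting P) (m : ℕ) : Measurable (M.h2Star P m) := by
  have : Measurable fun p : ℝ × Ω => M.h (M.Y 1 p.2) p.1 - M.thetaStar P m :=
    (measurable_h_comp hS ((hS.measurable_Y 1).comp measurable_snd) measurable_fst).sub_const _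
  exact this.stronglyMeasurable.integral_prod_right'.measurable

lemma measurable_r_comp {α : Type*} [MeasurableSpace α] (hS : M.Setting P) {f g : α → ℝ}
    (hf : Measurable f) (hg : Measurable g) : Measurable fun x => M.r P (f x) (g x) :=
  (((measurable_h_comp hS hf hg).sub ((measurable_h1 hS).comp hf)).sub
    ((measurable_h2 hS).comp hg)).sub_const _

lemma measurable_rStar_comp {α : Type*} [MeasurableSpace α] (hS : M.Setting P) (m : ℕ)
    {f g : α → ℝ} (hf : Measurable f) (hg : Measurable g) :
    Measurable fun x => M.rStar P m (f x) (g x) :=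
  (((measurable_h_comp hS hf hg).sub ((measurable_h1Star hS m).comp hf)).sub
    ((measurable_h2Star hS m).comp hg)).sub_const _

lemma measurable_X (hS : M.Setting P) (m i : ℕ) : Measurable (M.X m i) := by
  unfold X
  split_ifs
  · exact hS.measurable_Y _
  · exact hS.measurable_Z _ _

lemma measurable_S1 (hS : M.Setting P) (m : ℕ) : Measurable (M.S1 P m) := by
  refine Measurable.const_mul (Finset.measurable_sum _ fun i _ => ?_) _
  exact (measurable_h1 hS).comp (hS.measurable_Y i)

lemma measurable_S1Star (hS : M.Setting P) (m : ℕ) : Measurable (M.S1Star P m) := by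
  refine Measurable.const_mul (Finset.measurable_sum _ fun i _ => ?_) _
  exact (measurable_h1Star hS m).comp (hS.measurable_Y i)

lemma measurable_Gam (hS : M.Setting P) (m k : ℕ) : Measurable (M.Gam P m k) :=
  (Finset.measurable_sum _ fun i _ => Finset.measurable_sum _ fun j _ =>
    (measurable_h_comp hS (measurable_X hS m i) (measurable_X hS m j)).sub_const _).const_mul _

end Measurability

/-! ### The Hoeffding decomposition of the detector -/

section Decomposition

variable (P M)

/-- The linear part of the detector from the monitoring observations before the change. -/
noncomputable def noiseBefore (m : ℕ) (ω : Ω) : ℝ := blockSum (M.h2 P) M.Y m (M.kstar m) ω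

/-- The linear part of the detector from the first `l` observations after the change. -/
noncomputable def noiseAfter (m l : ℕ) (ω : Ω) : ℝ :=
  blockSum (M.h2Star P m) (M.Z m) (m + M.kstar m) l ω

/-- The degenerate part of the detector from the monitoring observations before the change. -/
noncomputable def remBefore (m : ℕ) (ω : Ω) : ℝ := ∑ i ∈ Finset.Icc 1 m,
  ∑ j ∈ Finset.Icc (m + 1) (m + M.kstar m), M.r P (M.Y (i : ℤ) ω) (M.Y (j : ℤ) ω)

/-- The degenerate part of the detector from the first `l` observations after the change. -/
noncomputable def remAfter (m l : ℕ) (ω : Ω) : ℝ := ∑ i ∈ Finset.Icc 1 m,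
  ∑ j ∈ Finset.Icc (m + M.kstar m + 1) (m + M.kstar m + l),
    M.rStar P m (M.Y (i : ℤ) ω) (M.Z m (j : ℤ) ω)

variable {P M}

lemma X_of_le {m i : ℕ} (h : i ≤ m + M.kstar m) (ω : Ω) : M.X m i ω = M.Y i ω :=
  if_pos (by omega)

lemma X_of_lt {m i : ℕ} (h : m + M.kstar m < i) (ω : Ω) : M.X m i ω = M.Z m i ω :=
  if_neg (by omega)

/-- The detector is the sum of its drift, given by the change and the historic statistics, and of
the noise from the monitoring period, by the Hoeffding decompositions of the kernel with respect to
the laws before and after the change. -/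
lemma Gam_eq {m : ℕ} (hm : 0 < m) (l : ℕ) (ω : Ω) :
    M.Gam P m (M.kstar m + l) ω = M.kstar m * (M.S1 P m ω / √(m : ℝ)) +
      l * (M.Delta P m + M.S1Star P m ω / √(m : ℝ)) +
      (M.noiseBefore P m ω + M.noiseAfter P m l ω +
        (M.remBefore P m ω + M.remAfter P m l ω) / m) := by
  have hm' : (0 : ℝ) < m := by exact_mod_cast hm
  have hsm : √(m : ℝ) * √(m : ℝ) = m := Real.mul_self_sqrt hm'.le
  have hS1 : ∀ s : ℝ, 1 / √(m : ℝ) * s / √(m : ℝ) = s / m := by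
    intro s
    rw [one_div_mul_eq_div, div_div, hsm]
  have hsplit : ∀ f : ℕ → ℝ, ∑ j ∈ Finset.Icc (m + 1) (m + (M.kstar m + l)), f j =
      ∑ j ∈ Finset.Icc (m + 1) (m + M.kstar m), f j +
        ∑ j ∈ Finset.Icc (m + M.kstar m + 1) (m + M.kstar m + l), f j := by
    intro f
    simp only [← Finset.Ico_succ_right_eq_Icc, Order.succ_eq_add_one]
    rw [Finset.sum_Ico_consecutive _ (by omega) (by omega)]
    simp [add_assoc]
  have hinner : ∀ i ∈ Finset.Icc 1 m,
      ∑ j ∈ Finset.Icc (m + 1) (m + (M.kstar m + l)),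
        (M.h (M.X m i ω) (M.X m j ω) - M.theta P) =
      M.kstar m * M.h1 P (M.Y i ω) + M.noiseBefore P m ω +
        ∑ j ∈ Finset.Icc (m + 1) (m + M.kstar m), M.r P (M.Y (i : ℤ) ω) (M.Y (j : ℤ) ω) +
      (l * (M.Delta P m + M.h1Star P m (M.Y i ω)) + M.noiseAfter P m l ω +
        ∑ j ∈ Finset.Icc (m + M.kstar m + 1) (m + M.kstar m + l),
          M.rStar P m (M.Y (i : ℤ) ω) (M.Z m (j : ℤ) ω)) := by
    intro i hi
    rw [Finset.mem_Icc] at hi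
    rw [hsplit]
    congr 1
    · rw [noiseBefore, blockSum, add_assoc ((M.kstar m : ℝ) * _), ← Finset.sum_add_distrib]
      have : (M.kstar m : ℝ) * M.h1 P (M.Y i ω) =
          ∑ _j ∈ Finset.Icc (m + 1) (m + M.kstar m), M.h1 P (M.Y i ω) := by
        simp
      rw [this, ← Finset.sum_add_distrib]
      refine Finset.sum_congr rfl fun j hj => ?_
      rw [Finset.mem_Icc] at hj
      rw [X_of_le (by omega), X_of_le hj.2, r]
      ring
    · rw [noiseAfter, blockSum, add_assoc ((l : ℝ) * _), ← Finset.sum_add_distrib]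
      have : (l : ℝ) * (M.Delta P m + M.h1Star P m (M.Y i ω)) =
          ∑ _j ∈ Finset.Icc (m + M.kstar m + 1) (m + M.kstar m + l),
            (M.Delta P m + M.h1Star P m (M.Y i ω)) := by
        simp [mul_add]
      rw [this, ← Finset.sum_add_distrib]
      refine Finset.sum_congr rfl fun j hj => ?_
      rw [Finset.mem_Icc] at hj
      rw [X_of_le (by omega), X_of_lt (by omega), rStar, Delta]
      ring
  rw [Gam, Finset.sum_congr rfl hinner]
  simp only [Finset.sum_add_distrib, ← Finset.mul_sum, Finset.sum_const, Nat.card_Icc,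
    Nat.add_sub_cancel, nsmul_eq_mul]
  rw [S1, S1Star, hS1, hS1, remBefore, remAfter]
  field_simp
  ring

end Decomposition

/-! ### Negligibility of the degenerate part -/

section Remainder

variable [IsProbabilityMeasure P]

lemma tendsto_abs_of_log_sq {u : ℕ → ℝ}
    (hu : Tendsto (fun m : ℕ => u m / (m : ℝ) ^ 2 * Real.log m ^ 2) atTop (𝓝 0)) :
    Tendsto (fun m : ℕ => |u m| / (m : ℝ) ^ 2 * Real.log m ^ 2) atTop (𝓝 0) := by
  have := hu.abs
  rw [abs_zero] at this
  refine this.congr fun m => ?_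
  rw [abs_mul, abs_div, abs_of_nonneg (sq_nonneg (m : ℝ)), abs_of_nonneg (sq_nonneg (Real.log m))]

lemma eventually_one_le_log : ∀ᶠ m : ℕ in atTop, 1 ≤ Real.log m :=
  (Real.tendsto_log_atTop.comp tendsto_natCast_atTop_atTop).eventually_ge_atTop 1

/-- Only the sum over the whole period before the change is needed, so Chebyshev's inequality is
enough. -/
lemma tendsto_remBefore (hS : M.Setting P) (hC : M.ChangeSize P) (hT : M.Threshold P)
    (hB : M.RegularBefore P) {δ : ℝ} (hδ : 0 < δ) :
    Tendsto (fun m => P {ω | δ * √(M.approxTime P m) < |M.remBefore P m ω / m|})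
      atTop (𝓝 0) := by
  obtain ⟨u, hu, hu0⟩ := hB.remainder
  have hlim : Tendsto (fun m : ℕ => ENNReal.ofReal
      (1 / δ ^ 2 * (|u m| / (m : ℝ) ^ 2 * Real.log m ^ 2))) atTop (𝓝 0) := by
    have := ENNReal.tendsto_ofReal ((tendsto_abs_of_log_sq hu0).const_mul (1 / δ ^ 2))
    rwa [mul_zero, ENNReal.ofReal_zero] at this
  refine tendsto_of_tendsto_of_tendsto_of_le_of_le' tendsto_const_nhds hlim (by simp) ?_
  filter_upwards [eventually_pos hC hT, approx_pos hC hT, eventually_one_le_log] with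
    m ⟨h1, h2, h3⟩ ⟨h4, h5, _, _⟩ hlog
  have hmeas : Measurable (M.remBefore P m) := Finset.measurable_sum _ fun i _ =>
    Finset.measurable_sum _ fun j _ => measurable_r_comp hS (hS.measurable_Y _) (hS.measurable_Y _)
  have hset : {ω | δ * √(M.approxTime P m) < |M.remBefore P m ω / m|} =
      {ω | δ * √(M.approxTime P m) * m < |M.remBefore P m ω|} := by
    ext ω
    rw [Set.mem_ofPred_eq, Set.mem_ofPred_eq, abs_div, abs_of_pos h1, lt_div_iff₀ h1]
  have hbound : ∫⁻ ω, ENNReal.ofReal (|M.remBefore P m ω| ^ 2) ∂P ≤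
      ENNReal.ofReal (|u m| * M.kstar m) := by
    rcases Nat.eq_zero_or_pos (M.kstar m) with hk | hk
    · simp [remBefore, hk]
    · refine (hu m (m + 1) (m + M.kstar m) le_rfl (by omega)).trans (ENNReal.ofReal_le_ofReal ?_)
      push_cast
      have : (m : ℝ) + M.kstar m - (m + 1) + 1 = M.kstar m := by ring
      rw [this]
      gcongr
      exact le_abs_self _
  rw [hset]
  refine (measure_lt_abs_le hmeas hbound (by positivity)).trans (ENNReal.ofReal_le_ofReal ?_)
  have hk : (M.kstar m : ℝ) ≤ M.approxTime P m := by
    rw [approxTime]; linarith [mul_pos h4 h1]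
  rw [mul_pow, mul_pow, Real.sq_sqrt h5.le]
  calc |u m| * M.kstar m / (δ ^ 2 * M.approxTime P m * m ^ 2)
      ≤ |u m| * M.approxTime P m / (δ ^ 2 * M.approxTime P m * m ^ 2) := by gcongr
    _ = 1 / δ ^ 2 * (|u m| / (m : ℝ) ^ 2 * 1) := by field_simp
    _ ≤ _ := by gcongr; exact one_le_pow₀ hlog

/-- The number of dyadic levels that are needed for blocks of length `2 * approxDelay` is
logarithmic in `m`, since `k*` is polynomially bounded. -/
lemma eventually_log_approxDelay_le (hS : M.Setting P) (hC : M.ChangeSize P)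
    (hT : M.Threshold P) : ∃ C : ℝ, ∀ᶠ m : ℕ in atTop,
      ((Nat.log 2 ⌊2 * M.approxDelay P m⌋₊ + 1 : ℕ) : ℝ) ≤ C * Real.log m := by
  refine ⟨(M.beta + 2) / Real.log 2 + 1, ?_⟩
  filter_upwards [eventually_pos hC hT, approx_pos hC hT, eventually_one_le_log,
    (tendsto_slopeRatio hC).eventually_le_const (show (0 : ℝ) < 1 / 2 by norm_num),
    tendsto_natCast_atTop_atTop.eventually_ge_atTop (M.lam + 1),
    eventually_ge_atTop 1] with m ⟨h1, h2, h3⟩ ⟨h4, h5, h6, _⟩ hlog hq hlam hm1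
  have hm1' : (1 : ℝ) ≤ m := by exact_mod_cast hm1
  have hl2 : 0 < Real.log 2 := Real.log_pos one_lt_two
  have hβ := hS.beta_nonneg
  have hlam0 := hS.lam_pos
  have hpoly : 2 * M.approxDelay P m ≤ (m : ℝ) ^ (M.beta + 2) := by
    have e1 : (m : ℝ) ^ M.beta ≤ (m : ℝ) ^ (M.beta + 1) :=
      Real.rpow_le_rpow_of_exponent_le hm1' (by linarith)
    have e2 : (m : ℝ) ≤ (m : ℝ) ^ (M.beta + 1) := by
      simpa using Real.rpow_le_rpow_of_exponent_le hm1' (show (1 : ℝ) ≤ M.beta + 1 by linarith)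
    calc 2 * M.approxDelay P m = (2 * M.slopeRatio P m) * (M.kstar m + m) := by
          rw [approxDelay]; ring
      _ ≤ 1 * (M.kstar m + m) := by gcongr; linarith
      _ ≤ M.lam * (m : ℝ) ^ (M.beta + 1) + (m : ℝ) ^ (M.beta + 1) := by
          rw [one_mul]
          gcongr
          exact (kstar_le hS m).trans (by gcongr)
      _ = (M.lam + 1) * (m : ℝ) ^ (M.beta + 1) := by ring
      _ ≤ m * (m : ℝ) ^ (M.beta + 1) := by gcongr
      _ = (m : ℝ) ^ (M.beta + 2) := by
          rw [show M.beta + 2 = 1 + (M.beta + 1) by ring, Real.rpow_add h1 1, Real.rpow_one]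
  set n := ⌊2 * M.approxDelay P m⌋₊ with hn
  have hlogn : (Nat.log 2 n : ℝ) ≤ (M.beta + 2) / Real.log 2 * Real.log m := by
    rcases Nat.eq_zero_or_pos n with h0 | h0
    · rw [h0]; simp; positivity
    · have e1 : ((2 : ℝ) ^ Nat.log 2 n) ≤ (m : ℝ) ^ (M.beta + 2) := by
        have : ((2 ^ Nat.log 2 n : ℕ) : ℝ) ≤ n := by
          exact_mod_cast Nat.pow_log_le_self 2 h0.ne'
        push_cast at this
        exact this.trans ((Nat.floor_le (by positivity)).trans hpoly)
      have e2 := Real.log_le_log (by positivity) e1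
      rw [Real.log_pow, Real.log_rpow h1] at e2
      rw [div_mul_eq_mul_div, le_div_iff₀ hl2]
      exact e2
  push_cast
  rw [add_mul, one_mul]
  linarith

/-- The maximal inequality costs the square of the number of dyadic levels, hence a factor
`(log m)²`. -/
lemma tendsto_remAfter (hS : M.Setting P) (hC : M.ChangeSize P) (hT : M.Threshold P)
    (hA : M.RegularAfter P) {δ : ℝ} (hδ : 0 < δ) :
    Tendsto (fun m => P {ω | ∃ l : ℕ, (l : ℝ) ≤ 2 * M.approxDelay P m ∧
      δ * √(M.approxTime P m) < |M.remAfter P m l ω / m|}) atTop (𝓝 0) := by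
  obtain ⟨u, hu, hu0⟩ := hA.remainder
  obtain ⟨C, hC'⟩ := eventually_log_approxDelay_le hS hC hT
  have hlim : Tendsto (fun m : ℕ => ENNReal.ofReal
      (4 * C ^ 2 / δ ^ 2 * (|u m| / (m : ℝ) ^ 2 * Real.log m ^ 2))) atTop (𝓝 0) := by
    have := ENNReal.tendsto_ofReal ((tendsto_abs_of_log_sq hu0).const_mul (4 * C ^ 2 / δ ^ 2))
    rwa [mul_zero, ENNReal.ofReal_zero] at this
  refine tendsto_of_tendsto_of_tendsto_of_le_of_le' tendsto_const_nhds hlim (by simp) ?_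
  have hL1 : ∀ᶠ m : ℕ in atTop, 1 ≤ M.approxDelay P m := by
    filter_upwards [(tendsto_errorRate_mul_approxDelay hS hC hT).eventually_ge_atTop 1,
      (tendsto_errorRate hS hC hT).eventually_le_const zero_lt_one, approx_pos hC hT] with
      m h1 h2 ⟨_, _, h3, _⟩
    exact h1.trans (mul_le_of_le_one_left h3.le h2)
  filter_upwards [eventually_pos hC hT, approx_pos hC hT, hC', approxDelay_le_approxTime hC,
    hL1] with m ⟨h1, h2, h3⟩ ⟨h4, h5, h6, _⟩ hlog hLa hL1
  set x : ℕ → Ω → ℝ := fun j ω => ∑ i ∈ Finset.Icc 1 m,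
    M.rStar P m (M.Y (i : ℤ) ω) (M.Z m ((m + M.kstar m + 1 + j : ℕ) : ℤ) ω) with hx
  have hxm : ∀ j, Measurable (x j) := fun j => Finset.measurable_sum _ fun i _ =>
    measurable_rStar_comp hS m (hS.measurable_Y _) (hS.measurable_Z _ _)
  have hblock : ∀ a b ω, ∑ j ∈ Finset.Ico a b, x j ω = ∑ i ∈ Finset.Icc 1 m,
      ∑ j ∈ Finset.Icc (m + M.kstar m + 1 + a) (m + M.kstar m + b),
        M.rStar P m (M.Y (i : ℤ) ω) (M.Z m (j : ℤ) ω) := by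
    intro a b ω
    rw [hx, Finset.sum_comm]
    refine Finset.sum_congr rfl fun i _ => ?_
    rw [← Finset.Ico_succ_right_eq_Icc, Order.succ_eq_add_one,
      show m + M.kstar m + b + 1 = b + (m + M.kstar m + 1) by omega,
      add_comm (m + M.kstar m + 1) a]
    exact Finset.sum_Ico_add (fun j : ℕ => M.rStar P m (M.Y (i : ℤ) ω) (M.Z m (j : ℤ) ω)) a b
      (m + M.kstar m + 1)
  set p := Nat.log 2 ⌊2 * M.approxDelay P m⌋₊ + 1 with hp
  have hsub : {ω | ∃ l : ℕ, (l : ℝ) ≤ 2 * M.approxDelay P m ∧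
      δ * √(M.approxTime P m) < |M.remAfter P m l ω / m|} ⊆
      {ω | ∃ l < 2 ^ p, δ * √(M.approxTime P m) * m < |∑ j ∈ Finset.range l, x j ω|} := by
    rintro ω ⟨l, hl, hlt⟩
    refine ⟨l, (Nat.le_floor hl).trans_lt (Nat.lt_pow_succ_log_self one_lt_two _), ?_⟩
    rw [abs_div, abs_of_pos h1, lt_div_iff₀ h1] at hlt
    rw [Finset.range_eq_Ico, hblock]
    exact hlt
  have hvar : ∀ a b, a < b → ∫⁻ ω, ENNReal.ofReal (|∑ j ∈ Finset.Ico a b, x j ω| ^ 2) ∂P ≤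
      ENNReal.ofReal (|u m| * ((b : ℝ) - a)) := by
    intro a b hab
    simp_rw [hblock]
    refine (hu m (m + M.kstar m + 1 + a) (m + M.kstar m + b) (by omega) (by omega)).trans
      (ENNReal.ofReal_le_ofReal ?_)
    push_cast
    have : (m : ℝ) + M.kstar m + b - (m + M.kstar m + 1 + a) + 1 = b - a := by ring
    rw [this]
    have hab' : (a : ℝ) ≤ b := by exact_mod_cast hab.le
    exact mul_le_mul_of_nonneg_right (le_abs_self _) (by linarith)
  refine (measure_mono hsub).trans ((measure_exists_lt_abs_sum_range_le hxm hvar p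
    (by positivity)).trans (ENNReal.ofReal_le_ofReal ?_))
  -- `2 ^ p` exceeds the block length by a factor of at most `2`
  have hpow : (2 : ℝ) ^ p ≤ 4 * M.approxTime P m := by
    have e0 : ⌊2 * M.approxDelay P m⌋₊ ≠ 0 := (Nat.floor_pos.2 (by linarith)).ne'
    have e1 : ((2 ^ Nat.log 2 ⌊2 * M.approxDelay P m⌋₊ : ℕ) : ℝ) ≤ 2 * M.approxDelay P m :=
      (Nat.cast_le.2 (Nat.pow_log_le_self 2 e0)).trans (Nat.floor_le (by positivity))
    push_cast at e1
    rw [hp, pow_succ]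
    linarith
  rw [mul_pow, mul_pow, Real.sq_sqrt h5.le]
  calc (p : ℝ) ^ 2 * 2 ^ p * |u m| / (δ ^ 2 * M.approxTime P m * m ^ 2)
      ≤ (C * Real.log m) ^ 2 * (4 * M.approxTime P m) * |u m| /
          (δ ^ 2 * M.approxTime P m * m ^ 2) := by gcongr
    _ = _ := by field_simp

end Remainder

end Model

end UStatMonitoring

namespace UStatMonitoring

namespace Model

variable {Ω : Type*} [MeasurableSpace Ω] {P : Measure Ω} [IsProbabilityMeasure P] {M : Model Ω}

/-! ### Control of the noise -/

lemma blockMaximaBounded_h2 (hS : M.Setting P) (hB : M.RegularBefore P) :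
    BlockMaximaBounded P (fun _ => M.h2 P) (fun _ => M.Y) :=
  blockMaximaBounded_of_isBoundedInProb (fun _ => measurable_h2 hS) (fun _ => hS.measurable_Y)
    (fun _ => hS.stationary_Y) (fun m => m) hB.partial_sums

lemma blockMaximaBounded_h2Star (hS : M.Setting P) (hA : M.RegularAfter P) :
    BlockMaximaBounded P (M.h2Star P) M.Z := by
  refine blockMaximaBounded_of_isBoundedInProb (measurable_h2Star hS) hS.measurable_Z
    hS.stationary_Z (fun m => m + M.kstar m) fun n hn => ?_
  have := hA.hajek_renyi 0 le_rfl (by norm_num) n hn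
  simpa only [sub_zero, Real.rpow_zero, mul_one, ← Real.sqrt_eq_rpow, blockSum] using this

lemma tendsto_inv_errorRate (hS : M.Setting P) (hC : M.ChangeSize P) (hT : M.Threshold P) :
    Tendsto (fun m => 1 / M.errorRate P m) atTop atTop := by
  simp only [one_div]
  exact tendsto_inv_nhdsGT_zero.comp (tendsto_nhdsWithin_iff.2
    ⟨tendsto_errorRate hS hC hT, (errorRate_spec hC hT).mono fun m h => h.1⟩)

/-- The level `√a₀ / (16 ε_m)`, where `a₀` is `approxTime`, is of larger order than the maxima of
sums over blocks of length `2 a₀`. -/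
lemma tendsto_noise_order (hS : M.Setting P) (hC : M.ChangeSize P) (hT : M.Threshold P) :
    Tendsto (fun m => √(M.approxTime P m) / (16 * M.errorRate P m) / √(2 * M.approxTime P m))
      atTop atTop := by
  refine tendsto_atTop_mono' _ ?_ ((tendsto_inv_errorRate hS hC hT).const_mul_atTop
    (show (0 : ℝ) < 1 / (16 * √2) by positivity))
  filter_upwards [approx_pos hC hT, errorRate_spec hC hT] with m ⟨_, h2, _, _⟩ ⟨h3, _⟩
  have := Real.sqrt_pos.2 h2
  rw [Real.sqrt_mul zero_le_two]
  exact le_of_eq (by field_simp)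

lemma tendsto_noiseBefore (hS : M.Setting P) (hC : M.ChangeSize P) (hT : M.Threshold P)
    (hB : M.RegularBefore P) :
    Tendsto (fun m => P {ω | √(M.approxTime P m) / (16 * M.errorRate P m) <
      |M.noiseBefore P m ω|}) atTop (𝓝 0) := by
  refine tendsto_measure_zero_mono ((blockMaximaBounded_h2 hS hB).tendsto_measure
    ((tendsto_approxTime hC hT).const_mul_atTop two_pos) (fun m => m)
    (tendsto_noise_order hS hC hT)) ?_
  filter_upwards [approx_pos hC hT, eventually_pos hC hT] with m ⟨h1, h2, _, _⟩ ⟨h3, _⟩ ω hω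
  refine ⟨M.kstar m, ?_, hω⟩
  have : (M.kstar m : ℝ) ≤ M.approxTime P m := by
    rw [approxTime]; linarith [mul_pos h1 h3]
  linarith

lemma tendsto_noiseAfter (hS : M.Setting P) (hC : M.ChangeSize P) (hT : M.Threshold P)
    (hA : M.RegularAfter P) :
    Tendsto (fun m => P {ω | ∃ l : ℕ, (l : ℝ) ≤ 2 * M.approxDelay P m ∧
      √(M.approxTime P m) / (16 * M.errorRate P m) < |M.noiseAfter P m l ω|}) atTop (𝓝 0) := by
  refine tendsto_measure_zero_mono ((blockMaximaBounded_h2Star hS hA).tendsto_measure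
    ((tendsto_approxTime hC hT).const_mul_atTop two_pos) (fun m => m + M.kstar m)
    (tendsto_noise_order hS hC hT)) ?_
  filter_upwards [approxDelay_le_approxTime hC] with m h ω
  rintro ⟨l, hl, hlt⟩
  exact ⟨l, by linarith, hlt⟩

/-- The noise hardly varies at times close to the approximate time of detection. -/
lemma tendsto_noiseAfter_sub (hS : M.Setting P) (hC : M.ChangeSize P) (hT : M.Threshold P)
    (hA : M.RegularAfter P) {δ : ℝ} (hδ : 0 < δ) :
    Tendsto (fun m => P {ω | ∃ l : ℕ,
      |(l : ℝ) - M.approxDelay P m| ≤ 20 * M.errorRate P m * M.approxDelay P m ∧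
      δ * √(M.approxTime P m) <
        |M.noiseAfter P m l ω - M.noiseAfter P m ⌊M.approxDelay P m⌋₊ ω|}) atTop (𝓝 0) := by
  -- the window has length `40 ε L`, and `1 ≤ ε L` accounts for the rounding of its left end
  set l₀ : ℕ → ℕ := fun m => ⌊(1 - 20 * M.errorRate P m) * M.approxDelay P m⌋₊ with hl₀
  have hτ : Tendsto (fun m => δ / 2 * √(M.approxTime P m) /
      √(41 * (M.errorRate P m * M.approxDelay P m))) atTop atTop := by
    refine tendsto_atTop_mono' _ ?_ ((Real.tendsto_sqrt_atTop.comp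
      (tendsto_inv_errorRate hS hC hT)).const_mul_atTop
      (show (0 : ℝ) < δ / (2 * √41) by positivity))
    filter_upwards [approx_pos hC hT, errorRate_spec hC hT, approxDelay_le_approxTime hC] with
      m ⟨_, h2, h3, _⟩ ⟨h4, _⟩ h5
    have e1 := Real.sqrt_pos.2 h4
    have e2 := Real.sqrt_pos.2 h3
    have e3 : √(M.approxDelay P m) ≤ √(M.approxTime P m) := Real.sqrt_le_sqrt h5
    simp only [Function.comp_apply]
    rw [Real.sqrt_mul (by norm_num), Real.sqrt_mul h4.le, Real.sqrt_div zero_le_one,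
      Real.sqrt_one, le_div_iff₀ (by positivity)]
    calc δ / (2 * √41) * (1 / √(M.errorRate P m)) *
          (√41 * (√(M.errorRate P m) * √(M.approxDelay P m)))
        = δ / 2 * √(M.approxDelay P m) := by field_simp
      _ ≤ _ := by gcongr
  refine tendsto_measure_zero_mono ((blockMaximaBounded_h2Star hS hA).tendsto_measure
    ((tendsto_errorRate_mul_approxDelay hS hC hT).const_mul_atTop (show (0 : ℝ) < 41 by norm_num))
    (fun m => m + M.kstar m + l₀ m) hτ) ?_
  filter_upwards [approx_pos hC hT, errorRate_spec hC hT,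
    (tendsto_errorRate hS hC hT).eventually_le_const (show (0 : ℝ) < 1 / 40 by norm_num),
    (tendsto_errorRate_mul_approxDelay hS hC hT).eventually_ge_atTop 1] with
    m ⟨_, h2, h3, _⟩ ⟨h4, _⟩ h5 h6
  rintro ω ⟨l, hl, hlt⟩
  set L := M.approxDelay P m
  set ε := M.errorRate P m
  rw [abs_le] at hl
  have hnn : 0 ≤ (1 - 20 * ε) * L := mul_nonneg (by linarith) h3.le
  have hl₀1 : (l₀ m : ℝ) ≤ (1 - 20 * ε) * L := Nat.floor_le hnn
  have hl₀2 : (1 - 20 * ε) * L < l₀ m + 1 := Nat.lt_floor_add_one _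
  have hfl : (⌊L⌋₊ : ℝ) ≤ L := Nat.floor_le h3.le
  have hle1 : l₀ m ≤ l := by
    have : (l₀ m : ℝ) ≤ l := by linarith [hl.1]
    exact_mod_cast this
  have hle2 : l₀ m ≤ ⌊L⌋₊ := Nat.floor_mono (by nlinarith)
  -- both times are reached from the start of the window by blocks of length `O(ε L)`
  have hdec : ∀ l' : ℕ, l₀ m ≤ l' → M.noiseAfter P m l' ω = M.noiseAfter P m (l₀ m) ω +
      blockSum (M.h2Star P m) (M.Z m) (m + M.kstar m + l₀ m) (l' - l₀ m) ω := by
    intro l' hl'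
    rw [noiseAfter, noiseAfter, ← blockSum_add, Nat.add_sub_cancel' hl']
  by_contra hcon
  simp only [Set.mem_ofPred_eq, not_exists, not_and, not_lt] at hcon
  have b1 := hcon (l - l₀ m) (by rw [Nat.cast_sub hle1]; linarith [hl.2])
  have b2 := hcon (⌊L⌋₊ - l₀ m) (by rw [Nat.cast_sub hle2]; linarith [hl.2])
  rw [hdec l hle1, hdec _ hle2, add_sub_add_left_eq_sub] at hlt
  have := abs_sub (blockSum (M.h2Star P m) (M.Z m) (m + M.kstar m + l₀ m) (l - l₀ m) ω)
    (blockSum (M.h2Star P m) (M.Z m) (m + M.kstar m + l₀ m) (⌊L⌋₊ - l₀ m) ω)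
  linarith

variable (P M) in
/-- The noise of the detector around the approximate time of detection, standardized. -/
noncomputable def standardizedNoise (m : ℕ) (ω : Ω) : ℝ :=
  (M.noiseBefore P m ω + M.noiseAfter P m ⌊M.approxDelay P m⌋₊ ω) / √(M.approxTime P m)

lemma lt_w_mul_iff {m : ℕ} (hm : 0 < m) (n : ℕ) (c y : ℝ) :
    c < w m n * y ↔ c * (m + n) / √(m : ℝ) < y := by
  have hm' : (0 : ℝ) < m := by exact_mod_cast hm
  have hs := Real.sqrt_pos.2 hm'
  have : √(m : ℝ) * (1 + (n : ℝ) / m) = (m + n) / √(m : ℝ) := by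
    rw [eq_div_iff hs.ne', mul_right_comm, Real.mul_self_sqrt hm'.le]
    field_simp
  rw [w, this, lt_inv_mul_iff₀ (by positivity)]
  rw [mul_comm, mul_div_assoc]

/-- Outside of events of vanishing probability, the crossings of the threshold before the time
`a_m + x b_m` are determined, up to small changes of `x`, by the standardized noise. -/
theorem exists_bad_event (hS : M.Setting P) (hC : M.ChangeSize P) (hT : M.Threshold P)
    (hB : M.RegularBefore P) (hA : M.RegularAfter P) (x : ℝ) {δ : ℝ} (hδ : 0 < δ) :
    ∃ B : ℕ → Set Ω, Tendsto (fun m => P (B m)) atTop (𝓝 0) ∧ ∀ᶠ m in atTop, ∀ ω ∉ B m,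
      0 < M.b P m (M.S1 P m ω) (M.S1Star P m ω) ∧
      ((∃ l : ℕ, 0 < l ∧ (M.kstar m : ℝ) + l ≤ M.a P m (M.S1 P m ω) (M.S1Star P m ω) +
          x * M.b P m (M.S1 P m ω) (M.S1Star P m ω) ∧
        M.c m < w m (M.kstar m + l) * |M.Gam P m (M.kstar m + l) ω|) →
        -(Real.sign (M.Delta P m)) * M.standardizedNoise P m ω ≤ x + δ) ∧
      (-(Real.sign (M.Delta P m)) * M.standardizedNoise P m ω ≤ x - δ →
        ∃ l : ℕ, 0 < l ∧ (M.kstar m : ℝ) + l ≤ M.a P m (M.S1 P m ω) (M.S1Star P m ω) +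
          x * M.b P m (M.S1 P m ω) (M.S1Star P m ω) ∧
        M.c m < w m (M.kstar m + l) * |M.Gam P m (M.kstar m + l) ω|) := by
  -- close to the time of detection there are three errors, each of relative size `η`: the two
  -- degenerate parts and the variation of the noise
  set η : ℝ := δ / 8 with hη
  have hη0 : 0 < η := by positivity
  refine ⟨_, tendsto_measure_zero_union (tendsto_measure_zero_union (tendsto_measure_zero_union
    (tendsto_measure_zero_union (tendsto_measure_zero_union (tendsto_measure_zero_union
    (hT.S1_bounded.tendsto_measure_lt (tendsto_inv_errorRate hS hC hT))
    (hT.S1Star_bounded.tendsto_measure_lt (tendsto_inv_errorRate hS hC hT)))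
    (tendsto_noiseBefore hS hC hT hB)) (tendsto_noiseAfter hS hC hT hA))
    (tendsto_remBefore hS hC hT hB hη0)) (tendsto_remAfter hS hC hT hA hη0))
    (tendsto_noiseAfter_sub hS hC hT hA hη0), ?_⟩
  have hε0 := tendsto_errorRate hS hC hT
  have hlim1 : Tendsto (fun m => 2 * |x| * M.errorRate P m) atTop (𝓝 0) := by
    simpa using hε0.const_mul (2 * |x|)
  have hlim2 : Tendsto (fun m => 8 * M.errorRate P m * |x| + 2 * M.errorRate P m + 3 * η) atTop
      (𝓝 (3 * η)) := by
    have := (((hε0.const_mul 8).mul_const |x|).add (hε0.const_mul 2)).add_const (3 * η)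
    simpa using this
  have hlim3 : Tendsto (fun m => 2 * η * (8 * M.errorRate P m)) atTop (𝓝 0) := by
    simpa using (hε0.const_mul 8).const_mul (2 * η)
  filter_upwards [eventually_pos hC hT, approx_pos hC hT, errorRate_spec hC hT,
    hε0.eventually_le_const (show (0 : ℝ) < 1 / 40 by norm_num),
    hlim1.eventually_le_const one_pos,
    hlim2.eventually_lt_const (show 3 * η < δ by rw [hη]; linarith),
    hlim3.eventually_le_const one_pos] with m
    ⟨hm, hc, hd⟩ ⟨hq0, ha0, hL0, hb0⟩ ⟨hε, e1, e2, e3, e4, e5⟩ hε40 hεx hεδ hεη ω hω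
  simp only [Set.mem_union, Set.mem_ofPred_eq, not_or, not_exists, not_and, not_lt] at hω
  obtain ⟨⟨⟨⟨⟨⟨w1, w2⟩, w3⟩, w4⟩, w5⟩, w6⟩, w7⟩ := hω
  have hmN : 0 < m := by exact_mod_cast hm
  set s := Real.sign (M.Delta P m) with hs_def
  have hΔ : M.Delta P m ≠ 0 := abs_pos.1 hd
  have hs : s = 1 ∧ M.Delta P m = |M.Delta P m| ∨ s = -1 ∧ M.Delta P m = -|M.Delta P m| := by
    rcases lt_or_gt_of_ne hΔ with h | h
    · right; exact ⟨Real.sign_of_neg h, by rw [abs_of_neg h, neg_neg]⟩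
    · left; exact ⟨Real.sign_of_pos h, (abs_of_pos h).symm⟩
  have hsΔ : s * M.Delta P m = |M.Delta P m| := by
    rcases hs with ⟨h1, h2⟩ | ⟨h1, h2⟩ <;> rw [h1]
    · rw [one_mul]; exact h2
    · rw [h2, abs_neg, abs_abs]; ring
  have hsabs : |s| = 1 := by
    rcases hs with ⟨h1, _⟩ | ⟨h1, _⟩ <;> simp [h1]
  have hsmul : ∀ y, |s * y| = |y| := fun y => by rw [abs_mul, hsabs, one_mul]
  set ε := M.errorRate P m
  have hsa := Real.sqrt_pos.2 ha0
  -- multiplication by the sign of the change reduces the claim to a positive change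
  have key := exists_crossing_sandwich (k := M.kstar m) (m := m) (c := M.c m)
    (d := |M.Delta P m|) (q := M.slopeRatio P m) (a₀ := M.approxTime P m)
    (L₀ := M.approxDelay P m) (S := s * M.S1 P m ω) (S' := s * M.S1Star P m ω) (ε := ε)
    (a := M.a P m (M.S1 P m ω) (M.S1Star P m ω)) (x := x) (δ := δ) (δ' := 3 * η)
    (T := -s * M.standardizedNoise P m ω) (b := M.b P m (M.S1 P m ω) (M.S1Star P m ω))
    (b₀ := M.approxScale P m) (G := fun l => s * M.Gam P m (M.kstar m + l) ω)
    (V := fun l => s * (M.noiseBefore P m ω + M.noiseAfter P m l ω +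
        (M.remBefore P m ω + M.remAfter P m l ω) / m))
    hm hc hd hε hε40 hεx hεδ rfl rfl rfl rfl rfl e1 e2 e3 e4 e5 (by rwa [hsmul]) (by rwa [hsmul])
    ?_ ?_ ?_ ?_
  · simp only [hsmul] at key
    simpa only [lt_w_mul_iff hmN, Nat.cast_add] using key
  · rw [a, ← hs_def, mul_comm s, mul_comm s, sub_mul]
  · intro l
    rw [Gam_eq hmN, ← hsΔ]
    ring
  · intro l hl
    rw [hsmul, add_div]
    have r1 := w4 l hl
    have r2 := w6 l hl
    have r3 : 2 * (η * √(M.approxTime P m)) ≤ √(M.approxTime P m) / (8 * ε) := by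
      rw [le_div_iff₀ (by positivity)]
      calc _ = 2 * η * (8 * ε) * √(M.approxTime P m) := by ring
        _ ≤ 1 * √(M.approxTime P m) := by gcongr
        _ = _ := one_mul _
    have r4 : √(M.approxTime P m) / (4 * ε) = √(M.approxTime P m) / (8 * ε) +
        (√(M.approxTime P m) / (16 * ε) + √(M.approxTime P m) / (16 * ε)) := by
      field_simp; norm_num
    rw [r4]
    calc _ ≤ |M.noiseBefore P m ω| + |M.noiseAfter P m l ω| +
          (|M.remBefore P m ω / m| + |M.remAfter P m l ω / m|) :=
          (abs_add_le _ _).trans (add_le_add (abs_add_le _ _) (abs_add_le _ _))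
      _ ≤ _ := by linarith
  · intro l hl
    have hεL : 20 * ε * M.approxDelay P m ≤ M.approxDelay P m := by
      have := mul_le_mul_of_nonneg_right hε40 hL0.le
      linarith
    have r1 := w7 l hl
    have r2 := w6 l (by linarith [(abs_le.1 hl).2])
    have e : s * (M.noiseBefore P m ω + M.noiseAfter P m l ω +
        (M.remBefore P m ω + M.remAfter P m l ω) / m) +
        -s * M.standardizedNoise P m ω * √(M.approxTime P m) =
        s * ((M.noiseAfter P m l ω - M.noiseAfter P m ⌊M.approxDelay P m⌋₊ ω) +
          (M.remBefore P m ω / m + M.remAfter P m l ω / m)) := by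
      rw [standardizedNoise, mul_assoc, div_mul_cancel₀ _ hsa.ne']
      ring
    rw [e, hsmul]
    calc _ ≤ |M.noiseAfter P m l ω - M.noiseAfter P m ⌊M.approxDelay P m⌋₊ ω| +
          (|M.remBefore P m ω / m| + |M.remAfter P m l ω / m|) :=
          (abs_add_le _ _).trans (add_le_add le_rfl (abs_add_le _ _))
      _ ≤ _ := by linarith

lemma measurable_standardizedNoise (hS : M.Setting P) (m : ℕ) :
    Measurable (M.standardizedNoise P m) :=
  ((measurable_blockSum (measurable_h2 hS) hS.measurable_Y _ _).add
    (measurable_blockSum (measurable_h2Star hS m) (hS.measurable_Z m) _ _)).div_const _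

/-- The standardized noise is a function of the monitoring data. -/
lemma indepFun_standardizedNoise (hS : M.Setting P) (hI : M.HistoricIndep P) (m : ℕ) :
    IndepFun (fun ω => (M.S1 P m ω, M.S1Star P m ω)) (M.standardizedNoise P m) P := by
  set F : (ℕ → ℝ) → ℝ := fun z => (∑ j ∈ Finset.range (M.kstar m), M.h2 P (z j) +
    ∑ j ∈ Finset.range ⌊M.approxDelay P m⌋₊, M.h2Star P m (z (M.kstar m + j))) /
      √(M.approxTime P m) with hF
  have hFm : Measurable F :=
    ((Finset.measurable_sum _ fun j _ => (measurable_h2 hS).comp (measurable_pi_apply _)).add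
      (Finset.measurable_sum _ fun j _ =>
        (measurable_h2Star hS m).comp (measurable_pi_apply _))).div_const _
  have hsum : ∀ (f : ℕ → ℝ) (p l : ℕ), ∑ j ∈ Finset.Icc (p + 1) (p + l), f j =
      ∑ j ∈ Finset.range l, f (p + (j + 1)) := by
    intro f p l
    rw [← Finset.Ico_succ_right_eq_Icc, Order.succ_eq_add_one, Finset.sum_Ico_eq_sum_range,
      show p + l + 1 - (p + 1) = l by omega]
    refine Finset.sum_congr rfl fun j _ => ?_
    congr 1
    omega
  have hcomp : M.standardizedNoise P m = F ∘ fun ω (j : ℕ) => M.X m (m + (j + 1)) ω := by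
    funext ω
    simp only [standardizedNoise, noiseBefore, noiseAfter, blockSum, hsum, hF,
      Function.comp_apply]
    congr 2
    · refine Finset.sum_congr rfl fun j hj => ?_
      rw [Finset.mem_range] at hj
      rw [X_of_le (by omega)]
    · refine Finset.sum_congr rfl fun j hj => ?_
      rw [X_of_lt (by omega), show m + (M.kstar m + j + 1) = m + M.kstar m + (j + 1) by omega]
  rw [hcomp]
  exact (hI m).comp measurable_id hFm

end Model

end UStatMonitoring

namespace UStatMonitoring

/-! ### Convergence in distribution -/

section Distribution

variable {Ω Ω₁ Ω₂ : Type*} [MeasurableSpace Ω] [MeasurableSpace Ω₁] [MeasurableSpace Ω₂]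
  {P : Measure Ω} [IsProbabilityMeasure P] {Q₁ : Measure Ω₁} [IsProbabilityMeasure Q₁]
  {Q₂ : Measure Ω₂} [IsProbabilityMeasure Q₂]

/-- Convergence in distribution only depends on the laws. -/
lemma tendstoInDistribution_of_map_eq {X X' : ℕ → Ω → ℝ} {Z : Ω₁ → ℝ} {Z' : Ω₂ → ℝ}
    (h : TendstoInDistribution X atTop Z (fun _ => P) Q₁) (hX' : ∀ m, AEMeasurable (X' m) P)
    (hXX' : ∀ m, P.map (X' m) = P.map (X m)) (hZ' : AEMeasurable Z' Q₂)
    (hZZ' : Q₂.map Z' = Q₁.map Z) :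
    TendstoInDistribution X' atTop Z' (fun _ => P) Q₂ := by
  refine ⟨hX', hZ', ?_⟩
  refine ProbabilityMeasure.tendsto_iff_forall_integral_tendsto.2 fun f => ?_
  have h1 := ProbabilityMeasure.tendsto_iff_forall_integral_tendsto.1 h.tendsto f
  change Tendsto (fun m => ∫ x, f x ∂(P.map (X m))) atTop (𝓝 (∫ x, f x ∂(Q₁.map Z))) at h1
  change Tendsto (fun m => ∫ x, f x ∂(P.map (X' m))) atTop (𝓝 (∫ x, f x ∂(Q₂.map Z')))
  simpa only [hXX', hZZ'] using h1

lemma tendstoInMeasure_zero_of_forall_lt {X : ℕ → Ω → ℝ}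
    (h : ∀ ε > 0, Tendsto (fun m => P {ω | ε < |X m ω|}) atTop (𝓝 0)) :
    TendstoInMeasure P X atTop fun _ => (0 : ℝ) := by
  rw [tendstoInMeasure_iff_norm]
  intro ε hε
  refine tendsto_measure_zero_mono (h (ε / 2) (by positivity)) (Eventually.of_forall fun m ω hω => ?_)
  have hω' : ε ≤ ‖X m ω - 0‖ := hω
  rw [sub_zero, Real.norm_eq_abs] at hω'
  change ε / 2 < |X m ω|
  linarith

lemma TendstoInDistribution.mul_of_tendsto_one {X : ℕ → Ω → ℝ} {Z : Ω₁ → ℝ}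
    (h : TendstoInDistribution X atTop Z (fun _ => P) Q₁) {c : ℕ → ℝ}
    (hc : Tendsto c atTop (𝓝 1)) :
    TendstoInDistribution (fun m ω => c m * X m ω) atTop Z (fun _ => P) Q₁ := by
  have hcm : TendstoInMeasure P (fun m (_ : Ω) => c m) atTop fun _ => (1 : ℝ) := by
    rw [tendstoInMeasure_iff_norm]
    intro ε hε
    refine tendsto_const_nhds.congr' ?_
    filter_upwards [Metric.tendsto_nhds.1 hc ε hε] with m hm
    rw [Real.dist_eq] at hm
    have : {x : Ω | ε ≤ ‖c m - 1‖} = ∅ :=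
      Set.eq_empty_of_forall_notMem fun _ h => absurd h (not_le.2 hm)
    rw [this, measure_empty]
  have := TendstoInDistribution.continuous_comp_prodMk_of_tendstoInMeasure_const
    (g := fun p : ℝ × ℝ => p.2 * p.1) (by fun_prop) h hcm (fun m => aemeasurable_const)
  simpa using this

/-- If `X m` converges in distribution to `N(0, v)`, then the distribution functions converge. -/
lemma tendsto_measureReal_le_of_gaussian {X : ℕ → Ω → ℝ} {v : ℝ} (hv : 0 < v)
    (h : TendstoInDistribution X atTop (id : ℝ → ℝ) (fun _ => P)
      (gaussianReal 0 v.toNNReal)) (y : ℝ) :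
    Tendsto (fun m => P.real {ω | X m ω ≤ y}) atTop (𝓝 (cdf (gaussianReal 0 1) (y / √v))) := by
  have hv' : v.toNNReal ≠ 0 := (Real.toNNReal_pos.2 hv).ne'
  have hlim : (gaussianReal 0 v.toNNReal).real (Set.Iic y) =
      cdf (gaussianReal 0 1) (y / √v) := by
    have hmap : gaussianReal 0 v.toNNReal = (gaussianReal 0 1).map (fun z => √v * z) := by
      rw [gaussianReal_map_const_mul]
      congr 1
      · simp
      · ext
        simp [Real.sq_sqrt hv.le, hv.le]
    rw [cdf_eq_real, hmap, map_measureReal_apply (by fun_prop) measurableSet_Iic]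
    congr 1
    ext z
    simp [le_div_iff₀ (Real.sqrt_pos.2 hv), mul_comm]
  have := ProbabilityMeasure.tendsto_measure_of_null_frontier_of_tendsto' h.tendsto
    (E := Set.Iic y) (by
      have := nullSingletonClass_gaussianReal (μ := 0) hv'
      simp [Measure.map_id])
  simp only [ProbabilityMeasure.coe_mk, Measure.map_id] at this
  have h2 := (ENNReal.tendsto_toReal (measure_ne_top _ _)).comp this
  change Tendsto _ _ (𝓝 ((gaussianReal 0 v.toNNReal).real (Set.Iic y))) at h2
  rw [hlim] at h2
  refine h2.congr fun m => ?_
  simp only [Function.comp_apply]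
  rw [Measure.map_apply_of_aemeasurable (h.forall_aemeasurable m) measurableSet_Iic]
  rfl

end Distribution

/-- Partial sums of two nearby lengths differ by less than the order `√n`. -/
lemma BlockMaximaBounded.tendsto_measure_sub {Ω E : Type*} [MeasurableSpace Ω] {P : Measure Ω}
    {g : ℕ → E → ℝ} {V : ℕ → ℤ → Ω → E} (h : BlockMaximaBounded P g V) {k k' n : ℕ → ℕ}
    (hn : Tendsto n atTop atTop)
    (hk : Tendsto (fun m => |(k m : ℝ) - k' m| / n m) atTop (𝓝 0)) {ε : ℝ} (hε : 0 < ε) :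
    Tendsto (fun m => P {ω | ε * √(n m : ℝ) <
      |blockSum (g m) (V m) 0 (k m) ω - blockSum (g m) (V m) 0 (k' m) ω|}) atTop (𝓝 0) := by
  have hn' : Tendsto (fun m => (n m : ℝ)) atTop atTop := tendsto_natCast_atTop_atTop.comp hn
  have hs : Tendsto (fun m => √(n m : ℝ)) atTop atTop := Real.tendsto_sqrt_atTop.comp hn'
  set N : ℕ → ℝ := fun m => |(k m : ℝ) - k' m| + √(n m : ℝ) with hN
  have hN0 : Tendsto N atTop atTop := tendsto_atTop_mono (fun m => by simp [hN]) hs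
  have hτ : Tendsto (fun m => ε * √(n m : ℝ) / √(N m)) atTop atTop := by
    have h1 : Tendsto (fun m => √(N m / n m)) atTop (𝓝 0) := by
      have : Tendsto (fun m => N m / n m) atTop (𝓝 0) := by
        have h2 := hk.add hs.inv_tendsto_atTop
        rw [add_zero] at h2
        refine h2.congr fun m => ?_
        simp only [hN, Pi.inv_apply, add_div, Real.sqrt_div_self']
        rw [one_div]
      simpa using this.sqrt
    have h2 : ∀ᶠ m in atTop, 0 < √(N m / n m) := by
      filter_upwards [hN0.eventually_gt_atTop 0, hn'.eventually_gt_atTop 0] with m h3 h4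
      positivity
    have h3 := (tendsto_inv_nhdsGT_zero.comp
      (tendsto_nhdsWithin_iff.2 ⟨h1, h2⟩)).const_mul_atTop hε
    refine h3.congr fun m => ?_
    simp only [Function.comp_apply]
    rw [Real.sqrt_div' _ (Nat.cast_nonneg _), inv_div, mul_div_assoc]
  refine tendsto_measure_zero_mono (h.tendsto_measure hN0 (fun m => min (k m) (k' m)) hτ)
    (Eventually.of_forall fun m ω hω => ?_)
  have key : ∀ a b : ℕ, a ≤ b → blockSum (g m) (V m) 0 b ω - blockSum (g m) (V m) 0 a ω =
      blockSum (g m) (V m) a (b - a) ω := by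
    intro a b hab
    have := blockSum_add (g m) (V m) 0 a (b - a) ω
    rw [Nat.add_sub_cancel' hab, zero_add] at this
    rw [this, add_sub_cancel_left]
  change ε * √(n m : ℝ) < _ at hω
  rcases le_total (k m) (k' m) with hle | hle
  · refine ⟨k' m - k m, ?_, ?_⟩
    · rw [Nat.cast_sub hle]
      linarith [neg_le_abs ((k m : ℝ) - k' m), Real.sqrt_nonneg (n m : ℝ)]
    · rw [abs_sub_comm, key _ _ hle] at hω
      rwa [min_eq_left hle]
  · refine ⟨k m - k' m, ?_, ?_⟩
    · rw [Nat.cast_sub hle]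
      linarith [le_abs_self ((k m : ℝ) - k' m), Real.sqrt_nonneg (n m : ℝ)]
    · rw [key _ _ hle] at hω
      rwa [min_eq_right hle]

/-- The limit of `partial sum before time ρ + partial sum after time ρ` for the components of a
bivariate Wiener process: these are independent, whatever the correlation of the components. -/
lemma IsBivariateWiener.map_eq {Ω' : Type*} [MeasurableSpace Ω'] {Q : Measure Ω'}
    [IsProbabilityMeasure Q] {B : unitInterval → Ω' → ℝ × ℝ} {σ σs γ : ℝ}
    (hB : IsBivariateWiener Q B σ σs γ) (t : unitInterval) :
    Q.map (fun ω => (B t ω).1 + ((B 1 ω).2 - (B t ω).2)) =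
      gaussianReal 0 (Real.toNNReal ((t : ℝ) * σ ^ 2 + (1 - t) * σs ^ 2)) := by
  have ht0 : (0 : unitInterval) ≤ t := unitInterval.nonneg'
  have ht1 : t ≤ 1 := unitInterval.le_one'
  have hind := (hB.indep_increments.indepFun_sub_sub ht0 ht1).comp measurable_fst measurable_snd
  have h1 := hB.gaussian_increments 0 t ht0 1 0
  have h2 := hB.gaussian_increments t 1 ht1 0 1
  have e1 : Prod.fst ∘ (B t - B 0) = fun ω => (B t ω).1 := by
    funext ω; simp [hB.zero]
  have e2 : Prod.snd ∘ (B 1 - B t) = fun ω => (B 1 ω).2 - (B t ω).2 := by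
    funext ω; simp
  rw [e1, e2] at hind
  have h1' : Q.map (fun ω => (B t ω).1) = gaussianReal 0 (Real.toNNReal ((t : ℝ) * σ ^ 2)) := by
    simpa [hB.zero] using h1
  have h2' : Q.map (fun ω => (B 1 ω).2 - (B t ω).2) =
      gaussianReal 0 (Real.toNNReal ((1 - (t : ℝ)) * σs ^ 2)) := by
    simpa using h2
  have := gaussianReal_add_gaussianReal_of_indepFun hind h1' h2'
  rw [add_zero, ← Real.toNNReal_add (mul_nonneg t.2.1 (sq_nonneg _))
    (mul_nonneg (by linarith [t.2.2]) (sq_nonneg _))] at this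
  exact this

namespace Model

variable {Ω : Type*} [MeasurableSpace Ω] {P : Measure Ω} [IsProbabilityMeasure P] {M : Model Ω}

/-! ### The relative sizes of the samples before and after the change -/

/-- Up to the factor `λ` and rounding, `rate` is the ratio of the two summands `k*` and
`slopeRatio * m` of `approxTime`. -/
lemma rate_eq {m : ℕ} (hm : 0 < (m : ℝ)) :
    M.rate P m = ENNReal.ofReal ((m : ℝ) ^ M.beta / (M.slopeRatio P m * m)) := by
  rw [rate, Real.rpow_sub_one hm.ne', slopeRatio]
  congr 1
  rw [div_mul_div_comm, div_mul_eq_mul_div, div_div_eq_mul_div, mul_comm (M.c m)]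

lemma kstar_gt (m : ℕ) : M.lam * (m : ℝ) ^ M.beta - 1 < M.kstar m :=
  Nat.sub_one_lt_floor _

lemma tendsto_kstar_of_rate_top (hS : M.Setting P) (hC : M.ChangeSize P) (hT : M.Threshold P)
    (hD : Tendsto (M.rate P) atTop (𝓝 ⊤)) :
    Tendsto M.kstar atTop atTop ∧
      Tendsto (fun m => M.kstar m / M.approxTime P m) atTop (𝓝 1) := by
  have hq := tendsto_slopeRatio_mul hC hT
  have hr : Tendsto (fun m : ℕ => (m : ℝ) ^ M.beta / (M.slopeRatio P m * m)) atTop atTop := by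
    rw [← ENNReal.tendsto_ofReal_nhds_top]
    refine hD.congr' ?_
    filter_upwards [eventually_pos hC hT] with m ⟨h1, _⟩
    exact rate_eq h1
  have hpow : Tendsto (fun m : ℕ => M.lam * (m : ℝ) ^ M.beta) atTop atTop := by
    refine Tendsto.const_mul_atTop hS.lam_pos ((hr.atTop_mul_atTop₀ hq).congr' ?_)
    filter_upwards [hq.eventually_gt_atTop 0] with m h
    exact div_mul_cancel₀ _ h.ne'
  have hk : Tendsto (fun m => (M.kstar m : ℝ)) atTop atTop :=
    tendsto_atTop_mono (fun m => (kstar_gt m).le) (tendsto_atTop_add_const_right _ (-1) hpow)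
  refine ⟨tendsto_natCast_atTop_iff.1 hk, ?_⟩
  have hratio : Tendsto (fun m => M.slopeRatio P m * m / M.kstar m) atTop (𝓝 0) := by
    have h1 := (hr.const_mul_atTop (half_pos hS.lam_pos)).inv_tendsto_atTop
    refine squeeze_zero' ?_ ?_ h1
    · filter_upwards [hq.eventually_gt_atTop 0] with m h
      positivity
    · filter_upwards [hq.eventually_gt_atTop 0, hpow.eventually_ge_atTop 2,
        hk.eventually_gt_atTop 0] with m h2 h3 h4
      have h5 := kstar_gt (M := M) m
      have h6 : 0 < M.lam * (m : ℝ) ^ M.beta := by linarith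
      have h7 : 0 < (m : ℝ) ^ M.beta := (pos_iff_pos_of_mul_pos h6).1 hS.lam_pos
      have h8 := hS.lam_pos
      rw [Pi.inv_apply, div_le_iff₀ h4, ← div_le_iff₀' (by positivity), div_inv_eq_mul]
      have : M.slopeRatio P m * m * (M.lam / 2 * ((m : ℝ) ^ M.beta / (M.slopeRatio P m * m))) =
          M.lam * (m : ℝ) ^ M.beta / 2 := by
        generalize M.slopeRatio P m * (m : ℝ) = y at h2
        field_simp
      rw [this]
      linarith
  have h1 : Tendsto (fun m => (1 + M.slopeRatio P m * m / M.kstar m)⁻¹) atTop (𝓝 1) := by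
    have := (hratio.const_add 1).inv₀ (by norm_num)
    simpa using this
  refine h1.congr' ?_
  filter_upwards [hk.eventually_gt_atTop 0] with m h
  rw [approxTime]
  field_simp

lemma tendsto_kstar_of_rate_lt_top (hS : M.Setting P) (hC : M.ChangeSize P) (hT : M.Threshold P)
    {D : ℝ≥0∞} (hDt : D ≠ ⊤) (hD : Tendsto (M.rate P) atTop (𝓝 D)) :
    Tendsto (fun m => M.kstar m / M.approxTime P m) atTop
      (𝓝 (M.lam * D.toReal / (1 + M.lam * D.toReal))) := by
  have hq := tendsto_slopeRatio_mul hC hT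
  have hlam := hS.lam_pos
  have hr : Tendsto (fun m : ℕ => (m : ℝ) ^ M.beta / (M.slopeRatio P m * m)) atTop
      (𝓝 D.toReal) := by
    refine ((ENNReal.tendsto_toReal hDt).comp hD).congr' ?_
    filter_upwards [eventually_pos hC hT, hq.eventually_gt_atTop 0] with m ⟨h1, _⟩ h2
    rw [Function.comp_apply, rate_eq h1, ENNReal.toReal_ofReal]
    have := Real.rpow_pos_of_pos h1 M.beta
    positivity
  have hratio : Tendsto (fun m => M.kstar m / (M.slopeRatio P m * m)) atTop
      (𝓝 (M.lam * D.toReal)) := by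
    have h1 := hr.const_mul M.lam
    have h2 := h1.sub hq.inv_tendsto_atTop
    rw [sub_zero] at h2
    refine tendsto_of_tendsto_of_tendsto_of_le_of_le' h2 h1 ?_ ?_
    · filter_upwards [hq.eventually_gt_atTop 0] with m h3
      rw [Pi.inv_apply, ← mul_div_assoc, ← one_div, ← sub_div]
      gcongr
      exact (kstar_gt m).le
    · filter_upwards [hq.eventually_gt_atTop 0] with m h3
      rw [← mul_div_assoc]
      gcongr
      exact kstar_le hS m
  have h0 : 1 + M.lam * D.toReal ≠ 0 := by
    have : 0 ≤ D.toReal := ENNReal.toReal_nonneg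
    positivity
  refine (hratio.div (hratio.const_add 1) h0).congr' ?_
  filter_upwards [hq.eventually_gt_atTop 0] with m h
  simp only [Pi.div_apply]
  rw [approxTime]
  generalize M.slopeRatio P m * (m : ℝ) = y at h
  field_simp
  rw [add_comm]

lemma tendsto_approxDelay_div (hC : M.ChangeSize P) (hT : M.Threshold P) {ρ : ℝ}
    (h : Tendsto (fun m => M.kstar m / M.approxTime P m) atTop (𝓝 ρ)) :
    Tendsto (fun m => M.approxDelay P m / M.approxTime P m) atTop (𝓝 (1 - ρ)) := by
  have := ((tendsto_slopeRatio hC).mul h).add (h.const_sub 1)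
  rw [zero_mul, zero_add] at this
  refine this.congr' ?_
  filter_upwards [approx_pos hC hT] with m ⟨_, h2, _, _⟩
  have : M.approxDelay P m = M.slopeRatio P m * M.kstar m +
      (M.approxTime P m - M.kstar m) := by
    rw [approxDelay, approxTime]; ring
  rw [this, add_div, sub_div, div_self h2.ne', mul_div_assoc]

/-! ### The central limit theorem for the standardized noise -/

/-- For late changes only the observations before the change matter. -/
lemma tendstoInDistribution_standardizedNoise_later (hS : M.Setting P) (hC : M.ChangeSize P)
    (hT : M.Threshold P) (hA : M.RegularAfter P) (hD : Tendsto (M.rate P) atTop (𝓝 ⊤)) {σ : ℝ}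
    (hL : M.LaterCLT P σ) :
    TendstoInDistribution (M.standardizedNoise P) atTop (id : ℝ → ℝ) (fun _ => P)
      (gaussianReal 0 (Real.toNNReal (σ ^ 2))) := by
  obtain ⟨hk, hk1⟩ := tendsto_kstar_of_rate_top hS hC hT hD
  have hL0 := tendsto_approxDelay_div hC hT hk1
  rw [sub_self] at hL0
  have hmB : ∀ m, Measurable (M.noiseBefore P m) := fun m =>
    measurable_blockSum (measurable_h2 hS) hS.measurable_Y _ _
  have hmA : ∀ m l, Measurable (M.noiseAfter P m l) := fun m l =>
    measurable_blockSum (measurable_h2Star hS m) (hS.measurable_Z m) _ _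
  have h1 : TendstoInDistribution (fun m ω => 1 / √(M.kstar m : ℝ) * M.noiseBefore P m ω) atTop
      (id : ℝ → ℝ) (fun _ => P) (gaussianReal 0 (Real.toNNReal (σ ^ 2))) := by
    refine tendstoInDistribution_of_map_eq (hL.clt M.kstar hk)
      (fun m => ((hmB m).const_mul _).aemeasurable) (fun m => ?_) aemeasurable_id rfl
    have := hS.stationary_Y.map_comp_shift hS.measurable_Y
      (F := fun z => 1 / √(M.kstar m : ℝ) * ∑ j ∈ Finset.Icc 1 (M.kstar m), M.h2 P (z (j : ℤ)))
      ((Finset.measurable_sum _ fun j _ =>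
        (measurable_h2 hS).comp (measurable_pi_apply _)).const_mul _) m
    simpa only [noiseBefore, blockSum_eq_sum_shift] using this
  have h2 : Tendsto (fun m => √(M.kstar m / M.approxTime P m)) atTop (𝓝 1) := by
    simpa using hk1.sqrt
  have h3 := TendstoInDistribution.mul_of_tendsto_one h1 h2
  have h4 : TendstoInMeasure P
      (fun m ω => M.noiseAfter P m ⌊M.approxDelay P m⌋₊ ω / √(M.approxTime P m)) atTop
      fun _ => (0 : ℝ) := by
    refine tendstoInMeasure_zero_of_forall_lt fun ε hε => ?_
    have hτ : Tendsto (fun m => ε * √(M.approxTime P m) / √(M.approxDelay P m)) atTop atTop := by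
      have e1 : Tendsto (fun m => √(M.approxDelay P m / M.approxTime P m)) atTop (𝓝 0) := by
        simpa using hL0.sqrt
      have e2 : ∀ᶠ m in atTop, 0 < √(M.approxDelay P m / M.approxTime P m) := by
        filter_upwards [approx_pos hC hT] with m ⟨_, a1, a2, _⟩
        positivity
      refine ((tendsto_inv_nhdsGT_zero.comp
        (tendsto_nhdsWithin_iff.2 ⟨e1, e2⟩)).const_mul_atTop hε).congr' ?_
      filter_upwards [approx_pos hC hT] with m ⟨_, a1, a2, _⟩
      simp only [Function.comp_apply]
      rw [Real.sqrt_div' _ a1.le, inv_div, mul_div_assoc]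
    have hLt : Tendsto (M.approxDelay P) atTop atTop := by
      refine tendsto_atTop_mono' _ ?_ (tendsto_slopeRatio_mul hC hT)
      filter_upwards [approx_pos hC hT] with m ⟨a0, _, _, _⟩
      rw [approxDelay]
      gcongr
      simp
    refine tendsto_measure_zero_mono ((blockMaximaBounded_h2Star hS hA).tendsto_measure hLt
      (fun m => m + M.kstar m) hτ) ?_
    filter_upwards [approx_pos hC hT] with m ⟨_, a1, a2, _⟩ ω hω
    have hω' : ε < |M.noiseAfter P m ⌊M.approxDelay P m⌋₊ ω / √(M.approxTime P m)| := hω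
    rw [abs_div, abs_of_pos (Real.sqrt_pos.2 a1), lt_div_iff₀ (Real.sqrt_pos.2 a1)] at hω'
    exact ⟨_, Nat.floor_le a2.le, hω'⟩
  have h5 := h3.add_of_tendstoInMeasure_const h4
    (fun m => ((hmA m _).div_const _).aemeasurable)
  simp only [id, add_zero] at h5
  refine h5.congr (fun m => Eventually.of_forall fun ω => ?_) (Eventually.of_forall fun _ => rfl)
  simp only [Pi.add_apply]
  rw [standardizedNoise, add_div, Real.sqrt_div (Nat.cast_nonneg _)]
  congr 1
  rcases Nat.eq_zero_or_pos (M.kstar m) with h0 | h0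
  · simp [noiseBefore, h0]
  · have : 0 < √(M.kstar m : ℝ) := Real.sqrt_pos.2 (by exact_mod_cast h0)
    field_simp

lemma tendstoInDistribution_partialSums (hS : M.Setting P) {σ σs : ℝ} (hF : M.JointFCLT P σ σs)
    {n : ℕ → ℕ} (hn : Tendsto n atTop atTop) (t : unitInterval) :
    TendstoInDistribution (fun m ω => 1 / √(n m : ℝ) *
      (blockSum (M.h2 P) M.Y 0 ⌊(n m : ℝ) * t⌋₊ ω +
        (blockSum (M.h2Star P m) (M.Z m) 0 (n m) ω -
          blockSum (M.h2Star P m) (M.Z m) 0 ⌊(n m : ℝ) * t⌋₊ ω))) atTop (id : ℝ → ℝ)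
      (fun _ => P) (gaussianReal 0 (Real.toNNReal ((t : ℝ) * σ ^ 2 + (1 - t) * σs ^ 2))) := by
  obtain ⟨Ω', _, Q, B, γ, hQ, hB, hconv⟩ := hF.fclt
  have hmeas : ∀ m, Measurable fun ω => 1 / √(n m : ℝ) *
      (blockSum (M.h2 P) M.Y 0 ⌊(n m : ℝ) * t⌋₊ ω +
        (blockSum (M.h2Star P m) (M.Z m) 0 (n m) ω -
          blockSum (M.h2Star P m) (M.Z m) 0 ⌊(n m : ℝ) * t⌋₊ ω)) := fun m =>
    ((measurable_blockSum (measurable_h2 hS) hS.measurable_Y _ _).add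
      ((measurable_blockSum (measurable_h2Star hS m) (hS.measurable_Z m) _ _).sub
      (measurable_blockSum (measurable_h2Star hS m) (hS.measurable_Z m) _ _))).const_mul _
  refine ⟨fun m => (hmeas m).aemeasurable, aemeasurable_id, ?_⟩
  refine ProbabilityMeasure.tendsto_iff_forall_integral_tendsto.2 fun f => ?_
  set L : (unitInterval → ℝ × ℝ) → ℝ := fun p => (p t).1 + ((p 1).2 - (p t).2) with hL
  have hev : ∀ s : unitInterval,
      Continuous fun p : unitInterval →ᵤ (ℝ × ℝ) => UniformFun.toFun p s := fun s =>
    (UniformFun.uniformContinuous_eval (ℝ × ℝ) s).continuous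
  have key := hconv n hn (fun p => f (L p))
    (f.continuous.measurable.comp (by fun_prop)) ⟨‖f‖, fun p => f.norm_coe_le_norm _⟩
    (f.continuous.comp ((hev t).fst.add ((hev 1).snd.sub (hev t).snd)))
  have hBm : Measurable fun ω => L fun s => B s ω :=
    (hB.measurable t).fst.add ((hB.measurable 1).snd.sub (hB.measurable t).snd)
  change Tendsto (fun m => ∫ x, f x ∂(P.map _)) atTop
    (𝓝 (∫ x, f x ∂((gaussianReal 0 (Real.toNNReal ((t : ℝ) * σ ^ 2 + (1 - t) * σs ^ 2))).map id)))
  rw [Measure.map_id, ← hB.map_eq t, integral_map hBm.aemeasurable f.continuous.aestronglyMeasurable]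
  refine key.congr fun m => ?_
  rw [integral_map (hmeas m).aemeasurable f.continuous.aestronglyMeasurable]
  refine integral_congr_ae (Eventually.of_forall fun ω => ?_)
  simp only [hL, partialSumPath, blockSum, Set.Icc.coe_one, mul_one, Nat.floor_natCast,
    zero_add]
  congr 1
  ring

/-- For earlier changes the observations before and after the change both contribute, and
stationarity moves the monitoring period to the beginning of the series. -/
lemma tendstoInDistribution_standardizedNoise_early (hS : M.Setting P) (hC : M.ChangeSize P)
    (hT : M.Threshold P) (hB : M.RegularBefore P) (hA : M.RegularAfter P) {D : ℝ≥0∞}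
    (hDt : D ≠ ⊤) (hD : Tendsto (M.rate P) atTop (𝓝 D)) {σ σs : ℝ} (hF : M.JointFCLT P σ σs) :
    TendstoInDistribution (M.standardizedNoise P) atTop (id : ℝ → ℝ) (fun _ => P)
      (gaussianReal 0 (Real.toNNReal (M.lam * D.toReal / (1 + M.lam * D.toReal) * σ ^ 2 +
        1 / (1 + M.lam * D.toReal) * σs ^ 2))) := by
  have hlamD : 0 ≤ M.lam * D.toReal := mul_nonneg hS.lam_pos.le ENNReal.toReal_nonneg
  set ρ := M.lam * D.toReal / (1 + M.lam * D.toReal) with hρ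
  have hρ0 : 0 ≤ ρ := by positivity
  have hρ1 : 1 - ρ = 1 / (1 + M.lam * D.toReal) := by rw [hρ]; field_simp; ring
  have hρ1' : ρ ≤ 1 := by
    have : 0 ≤ 1 - ρ := by rw [hρ1]; positivity
    linarith
  have hk := tendsto_kstar_of_rate_lt_top hS hC hT hDt hD
  have hL := tendsto_approxDelay_div hC hT hk
  have ha := tendsto_approxTime hC hT
  set ℓ : ℕ → ℕ := fun m => ⌊M.approxDelay P m⌋₊ with hℓ
  set n : ℕ → ℕ := fun m => M.kstar m + ℓ m with hn_def
  have hℓa : Tendsto (fun m => (ℓ m : ℝ) / M.approxTime P m) atTop (𝓝 (1 - ρ)) := by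
    have h2 := hL.sub ha.inv_tendsto_atTop
    rw [sub_zero] at h2
    refine tendsto_of_tendsto_of_tendsto_of_le_of_le' h2 hL ?_ ?_
    · filter_upwards [approx_pos hC hT] with m ⟨_, a1, a2, _⟩
      rw [Pi.inv_apply, ← one_div, ← sub_div]
      gcongr
      exact (Nat.sub_one_lt_floor _).le
    · filter_upwards [approx_pos hC hT] with m ⟨_, a1, a2, _⟩
      gcongr
      exact Nat.floor_le a2.le
  have hna : Tendsto (fun m => (n m : ℝ) / M.approxTime P m) atTop (𝓝 1) := by
    have := hk.add hℓa
    rw [add_sub_cancel] at this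
    refine this.congr fun m => ?_
    rw [hn_def, ← add_div]
    push_cast
    rfl
  have hn' : Tendsto (fun m => (n m : ℝ)) atTop atTop := by
    refine (hna.pos_mul_atTop one_pos ha).congr' ?_
    filter_upwards [approx_pos hC hT] with m ⟨_, a1, _, _⟩
    field_simp
  have hn : Tendsto n atTop atTop := tendsto_natCast_atTop_iff.1 hn'
  have hkn : Tendsto (fun m => (M.kstar m : ℝ) / n m) atTop (𝓝 ρ) := by
    have := hk.div hna one_ne_zero
    rw [div_one] at this
    refine this.congr' ?_
    filter_upwards [approx_pos hC hT] with m ⟨_, a1, _, _⟩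
    exact div_div_div_cancel_right₀ a1.ne' _ _
  set t : unitInterval := ⟨ρ, hρ0, hρ1'⟩ with ht
  set k' : ℕ → ℕ := fun m => ⌊(n m : ℝ) * t⌋₊ with hk'
  have hkk' : Tendsto (fun m => |(M.kstar m : ℝ) - k' m| / n m) atTop (𝓝 0) := by
    have h2 := ((hkn.sub_const ρ).abs).add hn'.inv_tendsto_atTop
    rw [sub_self, abs_zero, add_zero] at h2
    refine squeeze_zero' (Eventually.of_forall fun m => by positivity) ?_ h2
    filter_upwards [hn'.eventually_gt_atTop 0] with m hm
    have e1 : (k' m : ℝ) ≤ n m * ρ := Nat.floor_le (by positivity)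
    have e2 : n m * ρ - 1 < k' m := Nat.sub_one_lt_floor _
    rw [div_le_iff₀ hm, add_mul, Pi.inv_apply, inv_mul_cancel₀ hm.ne', ← abs_of_pos hm,
      ← abs_mul, abs_of_pos hm, sub_mul, div_mul_cancel₀ _ hm.ne']
    calc |(M.kstar m : ℝ) - k' m| = |(M.kstar m - ρ * n m) + (n m * ρ - k' m)| := by
          congr 1; ring
      _ ≤ |M.kstar m - ρ * n m| + |n m * ρ - k' m| := abs_add_le _ _
      _ ≤ _ := by
          gcongr
          rw [abs_le]; constructor <;> linarith
  have hmY : ∀ p l, Measurable (blockSum (M.h2 P) M.Y p l) := fun p l =>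
    measurable_blockSum (measurable_h2 hS) hS.measurable_Y _ _
  have hmZ : ∀ m p l, Measurable (blockSum (M.h2Star P m) (M.Z m) p l) := fun m p l =>
    measurable_blockSum (measurable_h2Star hS m) (hS.measurable_Z m) _ _
  -- the partial sums at the time of change instead of the limiting fraction
  set W : ℕ → Ω → ℝ := fun m ω => 1 / √(n m : ℝ) *
    (blockSum (M.h2 P) M.Y 0 (M.kstar m) ω +
      blockSum (M.h2Star P m) (M.Z m) (M.kstar m) (ℓ m) ω) with hW
  have hWm : ∀ m, Measurable (W m) := fun m => ((hmY _ _).add (hmZ m _ _)).const_mul _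
  have hWlim : TendstoInDistribution W atTop (id : ℝ → ℝ) (fun _ => P)
      (gaussianReal 0 (Real.toNNReal (ρ * σ ^ 2 + (1 - ρ) * σs ^ 2))) := by
    refine tendstoInDistribution_of_tendstoInMeasure_sub W _
      (tendstoInDistribution_partialSums hS hF hn t) ?_ fun m => (hWm m).aemeasurable
    refine tendstoInMeasure_zero_of_forall_lt fun ε hε => ?_
    refine tendsto_measure_zero_mono (tendsto_measure_zero_union
      ((blockMaximaBounded_h2 hS hB).tendsto_measure_sub hn hkk' (half_pos hε))
      ((blockMaximaBounded_h2Star hS hA).tendsto_measure_sub hn hkk' (half_pos hε))) ?_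
    filter_upwards [hn'.eventually_gt_atTop 0] with m hm ω hω
    have hs : 0 < √(n m : ℝ) := Real.sqrt_pos.2 hm
    by_contra hcon
    simp only [Set.mem_union, Set.mem_ofPred_eq, not_or, not_lt] at hcon
    obtain ⟨c1, c2⟩ := hcon
    have hadd := blockSum_add (M.h2Star P m) (M.Z m) 0 (M.kstar m) (ℓ m) ω
    rw [zero_add] at hadd
    have hdiff : (W - fun m ω => 1 / √(n m : ℝ) *
        (blockSum (M.h2 P) M.Y 0 ⌊(n m : ℝ) * t⌋₊ ω +
          (blockSum (M.h2Star P m) (M.Z m) 0 (n m) ω -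
            blockSum (M.h2Star P m) (M.Z m) 0 ⌊(n m : ℝ) * t⌋₊ ω))) m ω =
        ((blockSum (M.h2 P) M.Y 0 (M.kstar m) ω - blockSum (M.h2 P) M.Y 0 (k' m) ω) -
          (blockSum (M.h2Star P m) (M.Z m) 0 (M.kstar m) ω -
            blockSum (M.h2Star P m) (M.Z m) 0 (k' m) ω)) / √(n m : ℝ) := by
      simp only [Pi.sub_apply, hW, hn_def, hk', hadd]
      ring
    have hω' : ε < |(W - fun m ω => 1 / √(n m : ℝ) *
        (blockSum (M.h2 P) M.Y 0 ⌊(n m : ℝ) * t⌋₊ ω +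
          (blockSum (M.h2Star P m) (M.Z m) 0 (n m) ω -
            blockSum (M.h2Star P m) (M.Z m) 0 ⌊(n m : ℝ) * t⌋₊ ω))) m ω| := hω
    rw [hdiff, abs_div, abs_of_pos hs, lt_div_iff₀ hs] at hω'
    have := abs_sub (blockSum (M.h2 P) M.Y 0 (M.kstar m) ω - blockSum (M.h2 P) M.Y 0 (k' m) ω)
      (blockSum (M.h2Star P m) (M.Z m) 0 (M.kstar m) ω -
        blockSum (M.h2Star P m) (M.Z m) 0 (k' m) ω)
    linarith
  have hsq : Tendsto (fun m => √(n m / M.approxTime P m)) atTop (𝓝 1) := by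
    simpa using hna.sqrt
  have hlim := TendstoInDistribution.mul_of_tendsto_one hWlim hsq
  rw [hρ1] at hlim
  refine tendstoInDistribution_of_map_eq hlim
    (fun m => (measurable_standardizedNoise hS m).aemeasurable) (fun m => ?_) aemeasurable_id rfl
  set F : (ℤ → ℝ × ℝ) → ℝ := fun z => (∑ j ∈ Finset.Icc 1 (M.kstar m), M.h2 P (z (j : ℤ)).1 +
    ∑ j ∈ Finset.Icc 1 (ℓ m), M.h2Star P m (z ((j : ℤ) + (M.kstar m : ℤ))).2) /
      √(M.approxTime P m) with hFdef
  have hFm : Measurable F :=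
    ((Finset.measurable_sum _ fun j _ => (measurable_h2 hS).comp (measurable_pi_apply _).fst).add
      (Finset.measurable_sum _ fun j _ =>
        (measurable_h2Star hS m).comp (measurable_pi_apply _).snd)).div_const _
  have hshift := (hF.stationary m).map_comp_shift
    (fun i => (hS.measurable_Y i).prodMk (hS.measurable_Z m i)) hFm m
  have e1 : M.standardizedNoise P m =
      fun ω => F fun i => (M.Y (i + m) ω, M.Z m (i + m) ω) := by
    funext ω
    simp only [standardizedNoise, noiseBefore, noiseAfter, blockSum_eq_sum_shift, hFdef, hℓ]
    congr 2
    refine Finset.sum_congr rfl fun j _ => ?_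
    congr 2
    push_cast
    ring
  have e2 : (fun ω => √(n m / M.approxTime P m) * W m ω) =
      fun ω => F fun i => (M.Y i ω, M.Z m i ω) := by
    funext ω
    have hsum : F (fun i => (M.Y i ω, M.Z m i ω)) = (blockSum (M.h2 P) M.Y 0 (M.kstar m) ω +
        blockSum (M.h2Star P m) (M.Z m) (M.kstar m) (ℓ m) ω) / √(M.approxTime P m) := by
      simp only [blockSum_eq_sum_shift, hFdef, Nat.cast_zero, add_zero]
    rw [hsum, hW, Real.sqrt_div (Nat.cast_nonneg _)]
    rcases Nat.eq_zero_or_pos (n m) with h0 | h0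
    · have : M.kstar m = 0 ∧ ℓ m = 0 := by
        simpa [hn_def] using h0
      simp [this.1, this.2]
    · have : 0 < √(n m : ℝ) := Real.sqrt_pos.2 (by exact_mod_cast h0)
      field_simp
  rw [e1, e2]
  exact hshift

end Model

end UStatMonitoring

namespace UStatMonitoring

namespace Model

variable {Ω : Type*} [MeasurableSpace Ω] {P : Measure Ω} [IsProbabilityMeasure P] {M : Model Ω}

/-! ### The standardized delay time -/

lemma kappa_le_iff (m n : ℕ) (ω : Ω) : M.kappa P m ω ≤ n ↔
    ∃ k ≤ n, M.kstar m < k ∧ M.c m < w m k * |M.Gam P m k ω| := by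
  constructor
  · intro h
    have hne : {n : ℕ∞ | ∃ k : ℕ, n = k ∧ M.kstar m < k ∧
        M.c m < w m k * |M.Gam P m k ω|}.Nonempty := by
      by_contra hemp
      rw [Set.not_nonempty_iff_eq_empty] at hemp
      rw [kappa, hemp, sInf_empty] at h
      exact absurd h (by simp)
    obtain ⟨k, hk, hk'⟩ := csInf_mem hne
    rw [kappa, hk] at h
    exact ⟨k, by exact_mod_cast h, hk'⟩
  · rintro ⟨k, hkn, hk⟩
    have h1 : M.kappa P m ω ≤ (k : ℕ∞) := sInf_le (show (k : ℕ∞) ∈ {n : ℕ∞ |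
      ∃ k : ℕ, n = k ∧ M.kstar m < k ∧ M.c m < w m k * |M.Gam P m k ω|} from ⟨k, rfl, hk⟩)
    exact h1.trans (by exact_mod_cast hkn)

lemma measurable_kappa (hS : M.Setting P) (m : ℕ) : Measurable (M.kappa P m) := by
  have hle : ∀ n : ℕ, MeasurableSet {ω | M.kappa P m ω ≤ n} := by
    intro n
    have : {ω | M.kappa P m ω ≤ n} = ⋃ k ∈ Finset.range (n + 1),
        {ω | M.kstar m < k ∧ M.c m < w m k * |M.Gam P m k ω|} := by
      ext ω
      simp only [Set.mem_ofPred_eq, kappa_le_iff, Set.mem_iUnion, Finset.mem_range,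
        Nat.lt_succ_iff, exists_prop]
    rw [this]
    refine Finset.measurableSet_biUnion _ fun k _ => (MeasurableSet.const _).inter ?_
    exact measurableSet_lt measurable_const ((measurable_Gam hS m k).abs.const_mul _)
  refine measurable_to_countable' fun n => ?_
  induction n using ENat.recTopCoe with
  | top =>
    have : M.kappa P m ⁻¹' {⊤} = ⋂ n : ℕ, {ω | M.kappa P m ω ≤ n}ᶜ := by
      ext ω
      simp only [Set.mem_preimage, Set.mem_singleton_iff, Set.mem_iInter, Set.mem_compl_iff,
        Set.mem_ofPred_eq, not_le]
      exact ENat.eq_top_iff_forall_gt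
    rw [this]
    exact MeasurableSet.iInter fun n => (hle n).compl
  | coe n =>
    have : M.kappa P m ⁻¹' {(n : ℕ∞)} =
        {ω | M.kappa P m ω ≤ n} \ ⋃ j ∈ Finset.range n, {ω | M.kappa P m ω ≤ j} := by
      ext ω
      simp only [Set.mem_preimage, Set.mem_singleton_iff, Set.mem_sdiff, Set.mem_ofPred_eq,
        Set.mem_iUnion, Finset.mem_range, not_exists, not_le]
      constructor
      · intro h
        rw [h]
        exact ⟨le_rfl, fun j hj => by exact_mod_cast hj⟩
      · rintro ⟨h1, h2⟩
        obtain ⟨j, hj⟩ := ENat.ne_top_iff_exists.1 (ne_top_of_le_ne_top (ENat.natCast_ne_top n) h1)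
        rw [← hj] at h1 h2 ⊢
        have h3 : j ≤ n := by exact_mod_cast h1
        rcases h3.eq_or_lt with h4 | h4
        · rw [h4]
        · exact absurd (h2 j h4) (lt_irrefl _)
    rw [this]
    exact (hle n).diff (Finset.measurableSet_biUnion _ fun j _ => hle j)

lemma measurable_a_comp (hS : M.Setting P) (m : ℕ) :
    Measurable fun ω => M.a P m (M.S1 P m ω) (M.S1Star P m ω) := by
  have h1 := measurable_S1 hS m
  have h2 := measurable_S1Star hS m
  unfold a
  fun_prop

lemma measurable_standardizedDelay (hS : M.Setting P) (m : ℕ) :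
    Measurable (M.standardizedDelay P m) := by
  have h1 : Measurable fun ω => ((M.kappa P m ω : ℝ≥0∞) : EReal) :=
    measurable_coe_ennreal_ereal.comp (Measurable.of_discrete.comp (measurable_kappa hS m))
  have h2 := measurable_a_comp hS m
  have h3 : Measurable fun ω => (M.b P m (M.S1 P m ω) (M.S1Star P m ω))⁻¹ :=
    (h2.sqrt.div_const _).inv
  have : M.standardizedDelay P m = fun ω => (((M.kappa P m ω : ℝ≥0∞) : EReal) -
      (M.a P m (M.S1 P m ω) (M.S1Star P m ω) : ℝ)) *
        (((M.b P m (M.S1 P m ω) (M.S1Star P m ω))⁻¹ : ℝ) : EReal) := by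
    funext ω
    rw [standardizedDelay, div_eq_mul_inv, EReal.coe_inv]
  rw [this]
  exact (h1.sub h2.coe_real_ereal).mul h3.coe_real_ereal

/-- The standardized delay is at most `x` iff the threshold is crossed, after the change, not later
than `a_m + x b_m`. For `b_m > 0` the value `∞` of the delay stays `∞` when it is standardized. -/
lemma standardizedDelay_le_iff {m : ℕ} {ω : Ω}
    (hb : 0 < M.b P m (M.S1 P m ω) (M.S1Star P m ω)) (x : ℝ) :
    M.standardizedDelay P m ω ≤ x ↔ ∃ l : ℕ, 0 < l ∧
      (M.kstar m : ℝ) + l ≤ M.a P m (M.S1 P m ω) (M.S1Star P m ω) +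
        x * M.b P m (M.S1 P m ω) (M.S1Star P m ω) ∧
      M.c m < w m (M.kstar m + l) * |M.Gam P m (M.kstar m + l) ω| := by
  set a' := M.a P m (M.S1 P m ω) (M.S1Star P m ω)
  set b' := M.b P m (M.S1 P m ω) (M.S1Star P m ω)
  have hfin : ∀ n : ℕ, M.kappa P m ω = n →
      (M.standardizedDelay P m ω ≤ x ↔ (n : ℝ) ≤ a' + x * b') := by
    intro n hn
    have : M.standardizedDelay P m ω = (((n : ℝ) - a') / b' : ℝ) := by
      have hcast : (((n : ℕ∞) : ℝ≥0∞) : EReal) = ((n : ℝ) : EReal) := by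
        rw [ENat.toENNReal_coe]; rfl
      rw [standardizedDelay, hn, hcast, EReal.coe_div, EReal.coe_sub]
    rw [this, EReal.coe_le_coe_iff, div_le_iff₀ hb, sub_le_iff_le_add']
  constructor
  · intro h
    have hne : M.kappa P m ω ≠ ⊤ := by
      intro htop
      have hb' : (0 : EReal) < (b' : ℝ) := by exact_mod_cast hb
      rw [standardizedDelay, htop, ENat.toENNReal_top, EReal.coe_ennreal_top,
        EReal.top_sub_coe, EReal.top_div_of_pos_ne_top hb' (EReal.coe_ne_top _)] at h
      exact absurd h (by simp)
    obtain ⟨n, hn⟩ := ENat.ne_top_iff_exists.1 hne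
    have h1 := (hfin n hn.symm).1 h
    obtain ⟨k, hkn, hk, hcross⟩ := (kappa_le_iff m n ω).1 hn.symm.le
    refine ⟨k - M.kstar m, by omega, ?_, ?_⟩
    · rw [Nat.cast_sub hk.le]
      have : (k : ℝ) ≤ n := by exact_mod_cast hkn
      linarith
    · rwa [Nat.add_sub_cancel' hk.le]
  · rintro ⟨l, hl, hle, hcross⟩
    have h1 := (kappa_le_iff m (M.kstar m + l) ω).2 ⟨_, le_rfl, by omega, hcross⟩
    obtain ⟨n, hn⟩ := ENat.ne_top_iff_exists.1 (ne_top_of_le_ne_top (ENat.natCast_ne_top _) h1)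
    rw [hfin n hn.symm]
    rw [← hn] at h1
    have h2 : n ≤ M.kstar m + l := by exact_mod_cast h1
    have h3 : (n : ℝ) ≤ M.kstar m + l := by exact_mod_cast h2
    linarith

/-! ### The limit distribution -/

/-- The formula for `0 < D < ∞` also covers `D = 0`. -/
lemma limitVariance_of_ne_top {D : ℝ≥0∞} (hD : D ≠ ⊤) (σ σs : ℝ) :
    M.limitVariance D σ σs = M.lam * D.toReal / (1 + M.lam * D.toReal) * σ ^ 2 +
      1 / (1 + M.lam * D.toReal) * σs ^ 2 := by
  rw [limitVariance]
  split_ifs with h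
  · simp [h]
  · rfl

lemma limitVariance_pos (hS : M.Setting P) {D : ℝ≥0∞} {σ σs : ℝ}
    (hE : D ≠ ⊤ → M.JointFCLT P σ σs) (hL : D = ⊤ → M.LaterCLT P σ) :
    0 < M.limitVariance D σ σs := by
  by_cases hD : D = ⊤
  · have := (hL hD).sigma_pos
    simp only [limitVariance, hD, ENNReal.top_ne_zero, if_false, if_true]
    positivity
  · rw [limitVariance_of_ne_top hD]
    have h2 := (hE hD).sigmaStar_pos
    have h3 : 0 ≤ M.lam * D.toReal := mul_nonneg hS.lam_pos.le ENNReal.toReal_nonneg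
    positivity

lemma continuous_cdf_gaussian : Continuous (cdf (gaussianReal 0 1)) := by
  rw [continuous_iff_continuousAt]
  intro y
  have := nullSingletonClass_gaussianReal (μ := 0) (v := 1) one_ne_zero
  have h1 : (cdf (gaussianReal 0 1)).measure {y} = 0 := by
    rw [measure_cdf]; exact measure_singleton y
  rw [StieltjesFunction.measure_singleton, ENNReal.ofReal_eq_zero, sub_nonpos] at h1
  rw [(cdf (gaussianReal 0 1)).mono.continuousAt_iff_leftLim_eq_rightLim,
    StieltjesFunction.rightLim_eq]
  exact le_antisymm ((cdf (gaussianReal 0 1)).mono.leftLim_le le_rfl) h1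

/-- The sign of the change does not matter in the limit, since the limit law is symmetric. -/
lemma tendsto_cdf_signed_noise (hC : M.ChangeSize P) (hT : M.Threshold P) {v : ℝ} (hv : 0 < v)
    (h : TendstoInDistribution (M.standardizedNoise P) atTop (id : ℝ → ℝ) (fun _ => P)
      (gaussianReal 0 v.toNNReal)) (y : ℝ) :
    Tendsto (fun m => P.real {ω | -(Real.sign (M.Delta P m)) * M.standardizedNoise P m ω ≤ y})
      atTop (𝓝 (cdf (gaussianReal 0 1) (y / √v))) := by
  have hneg : TendstoInDistribution (fun m ω => -M.standardizedNoise P m ω) atTop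
      (id : ℝ → ℝ) (fun _ => P) (gaussianReal 0 v.toNNReal) := by
    have h1 := h.continuous_comp (g := fun z : ℝ => -z) continuous_neg
    refine tendstoInDistribution_of_map_eq h1 h1.forall_aemeasurable (fun _ => rfl)
      aemeasurable_id ?_
    have : (gaussianReal 0 v.toNNReal).map (fun z : ℝ => -z) = gaussianReal 0 v.toNNReal := by
      rw [gaussianReal_map_neg, neg_zero]
    rw [Measure.map_id]
    exact this.symm
  have h1 := tendsto_measureReal_le_of_gaussian hv h y
  have h2 := tendsto_measureReal_le_of_gaussian hv hneg y
  classical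
  refine (Tendsto.if' (p := fun m => M.Delta P m < 0) h1 h2).congr' ?_
  filter_upwards [eventually_pos hC hT] with m ⟨_, _, hd⟩
  rcases lt_or_gt_of_ne (abs_pos.1 hd) with h | h
  · simp [h, Real.sign_of_neg h]
  · simp [h.not_gt, Real.sign_of_pos h]

end Model

end UStatMonitoring

theorem mainTheorem1 {Ω : Type*} [MeasurableSpace Ω] (P : Measure Ω) [IsProbabilityMeasure P]
    (M : UStatMonitoring.Model Ω) (σ σs : ℝ) (D : ℝ≥0∞)
    (hSetting : M.Setting P)
    (hChange : M.ChangeSize P)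
    (hBefore : M.RegularBefore P)
    (hThreshold : M.Threshold P)
    (hIndep : M.HistoricIndep P)
    (hAfter : M.RegularAfter P)
    (hD : Tendsto (M.rate P) atTop (𝓝 D))
    (hEarly : D ≠ ⊤ → M.JointFCLT P σ σs)
    (hLater : D = ⊤ → M.LaterCLT P σ)
    (x : ℝ) :
    TendstoInMeasure P
      (fun m => P⟦{ω | M.standardizedDelay P m ω ≤ (x : EReal)} | M.historicSigma P m⟧)
      atTop
      (fun _ => cdf (gaussianReal 0 1) (x / √(M.limitVariance D σ σs))) := by
  have hv := UStatMonitoring.Model.limitVariance_pos hSetting hEarly hLater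
  have hclt : TendstoInDistribution (M.standardizedNoise P) atTop (id : ℝ → ℝ) (fun _ => P)
      (gaussianReal 0 (M.limitVariance D σ σs).toNNReal) := by
    by_cases hDt : D = ⊤
    · have : M.limitVariance D σ σs = σ ^ 2 := by
        simp [UStatMonitoring.Model.limitVariance, hDt]
      rw [this]
      exact UStatMonitoring.Model.tendstoInDistribution_standardizedNoise_later hSetting hChange
        hThreshold hAfter (hDt ▸ hD) (hLater hDt)
    · rw [UStatMonitoring.Model.limitVariance_of_ne_top hDt]
      exact UStatMonitoring.Model.tendstoInDistribution_standardizedNoise_early hSetting hChange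
        hThreshold hBefore hAfter hDt hD (hEarly hDt)
  refine UStatMonitoring.tendstoInMeasure_condExp_of_sandwich
    (E := fun m => {ω | M.standardizedDelay P m ω ≤ (x : EReal)})
    (T := fun m ω => -(Real.sign (M.Delta P m)) * M.standardizedNoise P m ω)
    (F := fun y => cdf (gaussianReal 0 1) (y / √(M.limitVariance D σ σs)))
    (fun m => ?_) (fun m => ?_) (fun m => ?_) (fun m => ?_) ?_ (fun y => ?_) (fun δ hδ => ?_)
  · exact ((UStatMonitoring.Model.measurable_S1 hSetting m).prodMk
      (UStatMonitoring.Model.measurable_S1Star hSetting m)).comap_le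
  · exact measurableSet_le (UStatMonitoring.Model.measurable_standardizedDelay hSetting m)
      measurable_const
  · exact (UStatMonitoring.Model.measurable_standardizedNoise hSetting m).const_mul _
  · exact ((UStatMonitoring.Model.indepFun_standardizedNoise hSetting hIndep m).comp
      measurable_id (measurable_const_mul (-(Real.sign (M.Delta P m))))).symm
  · exact (UStatMonitoring.Model.continuous_cdf_gaussian.comp
      (continuous_id.div_const _)).continuousAt
  · exact UStatMonitoring.Model.tendsto_cdf_signed_noise hChange hThreshold hv hclt y
  · obtain ⟨B, hB0, hB⟩ := UStatMonitoring.Model.exists_bad_event hSetting hChange hThreshold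
      hBefore hAfter x hδ
    refine ⟨B, hB0, hB.mono fun m hm ω hω => ?_⟩
    obtain ⟨h1, h2, h3⟩ := hm ω hω
    exact ⟨fun h => h2 ((UStatMonitoring.Model.standardizedDelay_le_iff h1 x).1 h),
      fun h => (UStatMonitoring.Model.standardizedDelay_le_iff h1 x).2 (h3 h)⟩
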